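/- **Theorem 1.** Let $X^d=(X_1,\dots,X_d)$ be random variables with finite ranges $\mathcal X_1,\dots,\mathcal X_d$, not all of them one-point sets, and with a fixed joint distribution $P_{X^d}$ such that $P_{X_i}(x_i)>0$ for all $i$ and $x_i$. Let $\mathbf B$ be the symmetric matrix of size $m=\sum_i|\mathcal X_i|$ with blocks $\mathbf B_{ii}=\mathbf I$ and, for $i\ne j$, $$B_{ij}(x_i;x_j)=\frac{P_{X_iX_j}(x_i,x_j)}{\sqrt{P_{X_i}(x_i)}\sqrt{P_{X_j}(x_j)}},$$ and let $\lambda^{(0)}\ge\lambda^{(1)}\ge\dots\ge\lambda^{(m-1)}$ be its eigenvalues, counted with multiplicity (put $\lambda^{(2)}=0$ if $m=2$). Let $\psi^{(0)}$ be the unit vector with entries $\sqrt{P_{X_i}(x_i)/d}$, let $\psi^{(1)}$ be any unit eigenvector of $\mathbf B$ for $\lambda^{(1)}$ that is orthogonal to $\psi^{(0)}$, and let $f_i^{(1)}(x_i)=\psi_i^{(1)}(x_i)/\sqrt{P_{X_i}(x_i)}$, where $\psi^{(1)}_i$ is the $i$-th block of $\psi^{(1)}$. Let $\mathcal U$ be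 a finite set with $|\mathcal U|\ge2$, and let $0<\gamma<1/|\mathcal U|$. For a joint distribution of $(U,X^d)$ on $\mathcal U\times\mathcal X_1\times\dots\times\mathcal X_d$ put $$\mathcal L(X^d|U)=D(P_{X^d}\|P_{X_1}\cdots P_{X_d})-\sum_{u}P_U(u)\,D(P_{X^d|U=u}\|P_{X_1|U=u}\cdots P_{X_d|U=u}).$$ For $\delta>0$, call a joint distribution $P_{UX^d}$ feasible if its marginal on $X^d$ is the given $P_{X^d}$, $I(U;X^d)\le\delta$, and $\min_uP_U(u)>\gamma$. For a distribution $P_U$ on $\mathcal U$ let $\mathcal P_{\exp}^{(\delta)}(P_U)$ be the set of the distributions $$\frac1Z\,P_U(u)\,P_{X^d}(x^d)\exp\Big(\sqrt{2\delta}\,\frac{h(u)}{\sqrt{\lambda^{(1)}}}\sum_{i=1}^df_i^{(1)}(x_i)\Big),$$ where $h:\mathcal U\to\mathbb R$ has mean $0$ and variance $1$ under $P_U$, and $Z$ is the normalizing constant. All asymptotics are as $\delta\to0^+$. 1. The optimal value, that is, the (finite) supremum of $\mathcal L(X^d|U)$ over the feasible distributions, is $\delta(\lambda^{(1)}-1)+o(\delta)$.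 2. This value is attained, to the order of approximation of the statement, by the exponential family. The family $\mathcal P_{\exp}^{(\delta)}(P_U)$ is nonempty for every $\delta>0$ and every $P_U$ with $\min_uP_U(u)>\gamma$. Whenever $R^{(\delta)}\in\mathcal P_{\exp}^{(\delta)}(P_U^{(\delta)})$ with $\min_uP_U^{(\delta)}(u)>\gamma$ for all small $\delta$, the distribution $R^{(\delta)}$ has $I(U;X^d)=\delta+o(\delta)$, its marginals on $X^d$ and on $U$ differ from $P_{X^d}$ and $P^{(\delta)}_U$ by $O(\delta)$, and its value is $\mathcal L(X^d|U)=\delta(\lambda^{(1)}-1)+o(\delta)$. Moreover there are feasible distributions (for all small $\delta$) that are entrywise within $o(\sqrt\delta)$ of $R^{(\delta)}$ and have $\mathcal L(X^d|U)=\delta(\lambda^{(1)}-1)+o(\delta)$. 3. Suppose that $\lambda^{(1)}>1$ and $\lambda^{(1)}>\lambda^{(2)}$. If $P^{(\delta)}_{UX^d}$ is feasible for all small $\delta$, with $\mathcal L(X^d|U)=\delta(\lambda^{(1)}-1)+o(\delta)$, then there are $\hat P^{(\delta)}_{UX^d}\in\mathcal P_{\exp}^{(\delta)}(P^{(\delta)}_U)$,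 for all small $\delta$ and with $P_U^{(\delta)}$ the marginal of $P^{(\delta)}_{UX^d}$ on $U$, such that for all $(u,x^d)$ $$\big|P^{(\delta)}_{UX^d}(u,x^d)-\hat P^{(\delta)}_{UX^d}(u,x^d)\big|=o(\sqrt\delta).$$ -/

import Mathlib

open Filter Topology Asymptotics

noncomputable section

namespace TotalCorr

section Basic

variable {α : Type*} [Fintype α]

/-- Kullback-Leibler divergence `D(p ‖ q)` (natural logarithm) of two mass functions on a finite
set, with `0 log (0 / b) = 0`. It is only used below for `p` absolutely continuous with respect
to `q`: a joint law against the product of its own marginals. -/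
def kl (p q : α → ℝ) : ℝ := ∑ a, p a * Real.log (p a / q a)

end Basic

section Tuple

variable {d : ℕ} {X : Fin d → Type*} [∀ i, Fintype (X i)] [∀ i, DecidableEq (X i)]

/-- The marginal `P_{X_i}` of a joint law on `X_1 × ⋯ × X_d`. -/
def coordMarginal (P : (∀ i, X i) → ℝ) (i : Fin d) (a : X i) : ℝ :=
  ∑ x with x i = a, P x

/-- The pairwise marginal `P_{X_i X_j}`. -/
def pairMarginal (P : (∀ i, X i) → ℝ) (i j : Fin d) (a : X i) (b : X j) : ℝ :=
  ∑ x with x i = a ∧ x j = b, P x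

/-- Total correlation `D(P_{X^d} ‖ P_{X_1} ⋯ P_{X_d})`. -/
def totalCorrelation (P : (∀ i, X i) → ℝ) : ℝ :=
  kl P (fun x => ∏ i, coordMarginal P i (x i))

/-- The block matrix `B`, with rows and columns indexed by the disjoint union of the alphabets:
identity matrices on the diagonal, and the blocks
`P_{X_i X_j}(a, b) / (√P_{X_i}(a) √P_{X_j}(b))` off the diagonal. -/
def pairwiseMatrix (P : (∀ i, X i) → ℝ) : Matrix (Σ i, X i) (Σ i, X i) ℝ :=
  Matrix.of fun p q =>
    if p.1 = q.1 then (if p = q then 1 else 0)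
    else pairMarginal P p.1 q.1 p.2 q.2 /
      (Real.sqrt (coordMarginal P p.1 p.2) * Real.sqrt (coordMarginal P q.1 q.2))

theorem pairMarginal_comm (P : (∀ i, X i) → ℝ) (i j : Fin d) (a : X i) (b : X j) :
    pairMarginal P i j a b = pairMarginal P j i b a := by
  simp only [pairMarginal, and_comm]

theorem pairwiseMatrix_isHermitian (P : (∀ i, X i) → ℝ) : (pairwiseMatrix P).IsHermitian := by
  ext p q
  simp only [Matrix.conjTranspose_apply, pairwiseMatrix, Matrix.of_apply, star_trivial]
  by_cases h : p.1 = q.1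
  · simp only [h, if_true, eq_comm]
  · have h2 : ¬ q.1 = p.1 := fun e => h e.symm
    simp only [h, h2, if_false]
    rw [pairMarginal_comm, mul_comm]

/-- `eig P k` is `λ^{(k)}`: the eigenvalues of `B`, with multiplicity, in the order
`λ^{(0)} ≥ λ^{(1)} ≥ ⋯ ≥ λ^{(m-1)}`, where `m = ∑ i, |X_i|` (and `0` for `k ≥ m`). -/
def eig (P : (∀ i, X i) → ℝ) (k : ℕ) : ℝ :=
  if h : k < Fintype.card (Σ i, X i) then (pairwiseMatrix_isHermitian P).eigenvalues₀ ⟨k, h⟩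
  else 0

/-- The top eigenvector `ψ^{(0)} = d^{-1/2} [v_1; …; v_d]`, `v_i(a) = √P_{X_i}(a)`. -/
def psiZero (P : (∀ i, X i) → ℝ) : (Σ i, X i) → ℝ :=
  fun p => (Real.sqrt d)⁻¹ * Real.sqrt (coordMarginal P p.1 p.2)

/-- `ψ` is an admissible choice of `ψ^{(1)}`: a unit eigenvector of `B` for `λ^{(1)}`, orthogonal
to `ψ^{(0)}`. -/
structure IsSecondEigenvector (P : (∀ i, X i) → ℝ) (ψ : (Σ i, X i) → ℝ) : Prop where
  eigen : Matrix.mulVec (pairwiseMatrix P) ψ = eig P 1 • ψ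
  unit : ∑ p, ψ p ^ 2 = 1
  orthogonal : ∑ p, psiZero P p * ψ p = 0

/-- The function `f_i(a) = ψ_i(a) / √P_{X_i}(a)` attached to `ψ`. -/
def feature (P : (∀ i, X i) → ℝ) (ψ : (Σ i, X i) → ℝ) (i : Fin d) (a : X i) : ℝ :=
  ψ ⟨i, a⟩ / Real.sqrt (coordMarginal P i a)

end Tuple

section Attribute

variable {𝒰 : Type*} [Fintype 𝒰]

/-- The set `H` of functions of `U ∼ PU` with zero mean and unit variance. -/
def unitFunctions (PU : 𝒰 → ℝ) : Set (𝒰 → ℝ) :=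
  {h | ∑ u, PU u * h u = 0 ∧ ∑ u, PU u * h u ^ 2 = 1}

/-- The law of `U` under a joint law of `(U, X)`. -/
def marginalU {β : Type*} [Fintype β] (Q : 𝒰 × β → ℝ) (u : 𝒰) : ℝ := ∑ x, Q (u, x)

/-- The law of `X` under a joint law of `(U, X)`. -/
def marginalX {β : Type*} (Q : 𝒰 × β → ℝ) (x : β) : ℝ := ∑ u, Q (u, x)

/-- The conditional law of `X` given `U = u`. -/
def condX {β : Type*} [Fintype β] (Q : 𝒰 × β → ℝ) (u : 𝒰) (x : β) : ℝ :=
  Q (u, x) / marginalU Q u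

/-- Mutual information `I(U; X)`. -/
def mutualInfo {β : Type*} [Fintype β] (Q : 𝒰 × β → ℝ) : ℝ :=
  kl Q (fun z => marginalU Q z.1 * marginalX Q z.2)

variable {d : ℕ} {X : Fin d → Type*} [∀ i, Fintype (X i)] [∀ i, DecidableEq (X i)]

/-- `L(X^d | U) = D(P_{X^d} ‖ P_{X_1} ⋯ P_{X_d}) - D(P_{X^d} ‖ P_{X_1} ⋯ P_{X_d} | U)`, the
reduction of the total correlation of `X^d` by the knowledge of `U`. The second divergence is
the average over `u` of the total correlation of the conditional law of `X^d` given `U = u`. -/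
def reduction (Q : 𝒰 × (∀ i, X i) → ℝ) : ℝ :=
  totalCorrelation (marginalX Q) - ∑ u, marginalU Q u * totalCorrelation (condX Q u)

/-- The joint laws of `(U, X^d)` over which one maximizes: the law of `X^d` is the given `P`,
`I(U; X^d) ≤ δ` and `min_u P_U(u) > γ`. -/
def feasible (𝒰 : Type*) [Fintype 𝒰] (P : (∀ i, X i) → ℝ) (γ δ : ℝ) :
    Set (𝒰 × (∀ i, X i) → ℝ) :=
  {Q | Q ∈ stdSimplex ℝ (𝒰 × (∀ i, X i)) ∧ marginalX Q = P ∧ mutualInfo Q ≤ δ ∧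
    ∀ u, γ < marginalU Q u}

/-- The unnormalized member of the exponential family
`PU(u) P(x) exp (√(2δ) h(u) / √λ^{(1)} ∑ i, f_i(x_i))`. -/
def expWeight (P : (∀ i, X i) → ℝ) (ψ : (Σ i, X i) → ℝ) (PU : 𝒰 → ℝ) (δ : ℝ) (h : 𝒰 → ℝ) :
    𝒰 × (∀ i, X i) → ℝ :=
  fun z => PU z.1 * P z.2 *
    Real.exp (Real.sqrt (2 * δ) * (h z.1 / Real.sqrt (eig P 1)) * ∑ i, feature P ψ i (z.2 i))

/-- The exponential family of joint laws of `(U, X^d)` with base law `PU ⊗ P`. -/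
def expFamily (P : (∀ i, X i) → ℝ) (ψ : (Σ i, X i) → ℝ) (PU : 𝒰 → ℝ) (δ : ℝ) :
    Set (𝒰 × (∀ i, X i) → ℝ) :=
  {R | ∃ h ∈ unitFunctions PU,
    R = fun z => (∑ w, expWeight P ψ PU δ h w)⁻¹ * expWeight P ψ PU δ h z}

end Attribute

end TotalCorr

end

open TotalCorr

noncomputable section

namespace TotalCorr

/-! The chain rule gives L(X^d|U) = ∑ I(U;X_i) - I(U;X^d) (`reduction_eq`), so only mutual
informations near a product law matter. Write a feasible law as P_U P (1 + ε). A Hellinger bound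
turns I(U;X^d) ≤ δ into |ε| = O(√δ), uniformly in P_U because P_U > γ
(`exists_expansion_of_feasible`). To second order I(U;X^d) is E[ε²]/2 and, since the law of (U, X_i)
is perturbed by the conditional mean of ε given (U, X_i), L is (E[energy of ε(U,·)] - E[ε²])/2, with
errors O(δ^{3/2}) (`abs_sub_le_of_feasible`).

The energy is ‖Tg‖², where Tg has the entries √P_{X_i}(a) E[g | X_i = a]. The adjoint of T is
`featureSum` and T T* = B (`mulVec_pairwiseMatrix`, `sum_mul_sqrt_mul_condMean`). If g has mean
zero, then Tg is orthogonal to ψ^{(0)}, so the energy is at most λ^{(1)} E[g²]. As λ^{(1)} ≥ 1, the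
constraint gives L ≤ δ(λ^{(1)} - 1) + O(δ^{3/2}) (`exists_reduction_le`).

Equality to leading order holds along g = F = ∑ f_i, the direction of the exponential family. A
member of the family agrees to first order with a tangent law having the exact marginals, and a
slight shrinking makes the latter feasible (`tangent_mem_feasible`, `exists_bounds_expFamily`).

For the converse, split ε = c(u) F + r with r orthogonal to F. The gap λ^{(1)} > λ^{(2)} makes any
mass in r costly, and λ^{(1)} > 1 forces the information budget to be used up. Hence E[r²] = o(δ)
and λ^{(1)} E[c²] = 2δ + o(δ); normalizing c yields h (`exists_decomposition_of_feasible`,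
`exists_expFamily_near`). -/

theorem abs_one_add_mul_log_sub_le {t : ℝ} (ht : |t| ≤ 1 / 2) :
    |(1 + t) * Real.log (1 + t) - t - t ^ 2 / 2| ≤ 4 * |t| ^ 3 := by
  have h1 := Real.abs_log_sub_add_sum_range_le (x := -t) (by rw [abs_neg]; linarith) 2
  simp only [Finset.sum_range_succ, Finset.sum_range_zero, abs_neg, sub_neg_eq_add] at h1
  norm_num at h1
  set l := Real.log (1 + t)
  have h2 : |t| ^ 3 / (1 - |t|) ≤ 2 * |t| ^ 3 := by
    rw [div_le_iff₀ (by linarith)]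
    nlinarith [pow_nonneg (abs_nonneg t) 3]
  have h3 : |-t + t ^ 2 / 2 + l| ≤ 2 * |t| ^ 3 := h1.trans h2
  -- Here (1 + t)(t - t²/2) = t + t²/2 - t³/2, which accounts for the extra cubic term.
  have e : (1 + t) * l - t - t ^ 2 / 2 = (1 + t) * (-t + t ^ 2 / 2 + l) + -(t ^ 3 / 2) := by ring
  rw [e]
  have h4 : |1 + t| ≤ 3 / 2 := by
    rw [abs_le] at ht ⊢; constructor <;> linarith
  calc _ ≤ |(1 + t) * (-t + t ^ 2 / 2 + l)| + |-(t ^ 3 / 2)| := abs_add_le _ _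
    _ = |1 + t| * |-t + t ^ 2 / 2 + l| + |t| ^ 3 / 2 := by
      rw [abs_mul, abs_neg, abs_div, abs_pow]; norm_num
    _ ≤ 3 / 2 * (2 * |t| ^ 3) + |t| ^ 3 / 2 := by gcongr
    _ ≤ _ := by nlinarith [pow_nonneg (abs_nonneg t) 3]

/-! ### Divergence on a finite set: local expansion and Hellinger lower bound. -/

section KL

variable {α : Type*} [Fintype α]

theorem abs_sum_mul_le {w f : α → ℝ} {c : ℝ} (hw : ∀ a, 0 ≤ w a) (hw1 : ∑ a, w a ≤ 1)
    (hc : 0 ≤ c) (hf : ∀ a, |f a| ≤ c) : |∑ a, w a * f a| ≤ c := by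
  calc |∑ a, w a * f a| ≤ ∑ a, |w a * f a| := Finset.abs_sum_le_sum_abs _ _
    _ ≤ ∑ a, w a * c := by
      refine Finset.sum_le_sum fun a _ => ?_
      rw [abs_mul, abs_of_nonneg (hw a)]
      exact mul_le_mul_of_nonneg_left (hf a) (hw a)
    _ = (∑ a, w a) * c := by rw [Finset.sum_mul]
    _ ≤ c := by nlinarith

/-- Second order expansion of the divergence of `q (1 + t)` from `q`. -/
theorem abs_kl_sub_le {p q t : α → ℝ} {η : ℝ} (hq : ∀ a, 0 ≤ q a) (hq1 : ∑ a, q a = 1)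
    (hp1 : ∑ a, p a = 1) (hpq : ∀ a, p a = q a * (1 + t a)) (hη : η ≤ 1 / 2)
    (ht : ∀ a, |t a| ≤ η) :
    |kl p q - (∑ a, q a * t a ^ 2) / 2| ≤ 4 * η ^ 3 := by
  -- Both mass functions have total mass 1, so the linear term of the expansion vanishes.
  have h0 : ∑ a, q a * t a = 0 := by
    have : ∑ a, p a = ∑ a, q a + ∑ a, q a * t a := by
      rw [← Finset.sum_add_distrib]
      exact Finset.sum_congr rfl fun a _ => by rw [hpq]; ring
    linarith
  have hne : Nonempty α := by
    by_contra h
    rw [not_nonempty_iff] at h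
    simp at hq1
  have hη0 : 0 ≤ η := (abs_nonneg _).trans (ht hne.some)
  have e : kl p q - (∑ a, q a * t a ^ 2) / 2
      = ∑ a, q a * ((1 + t a) * Real.log (1 + t a) - t a - t a ^ 2 / 2) := by
    have : kl p q = ∑ a, q a * ((1 + t a) * Real.log (1 + t a)) := by
      refine Finset.sum_congr rfl fun a _ => ?_
      rcases (hq a).eq_or_lt with h | h
      · simp [hpq, ← h]
      · rw [hpq, mul_div_cancel_left₀ _ h.ne', mul_assoc]
    rw [this, Finset.sum_div, ← sub_zero (∑ a, _ - _), ← h0, ← Finset.sum_sub_distrib,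
      ← Finset.sum_sub_distrib]
    exact Finset.sum_congr rfl fun a _ => by ring
  rw [e]
  refine abs_sum_mul_le hq hq1.le (by positivity) fun a => ?_
  refine (abs_one_add_mul_log_sub_le ((ht a).trans hη)).trans ?_
  gcongr
  exact ht a

/-- Serves for the corrections due to inexact marginals, where only the order of magnitude matters.
-/
theorem abs_kl_le {p q t : α → ℝ} {η : ℝ} (hq : ∀ a, 0 ≤ q a) (hq1 : ∑ a, q a = 1)
    (hp1 : ∑ a, p a = 1) (hpq : ∀ a, p a = q a * (1 + t a)) (hη : η ≤ 1 / 2)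
    (ht : ∀ a, |t a| ≤ η) :
    |kl p q| ≤ 3 * η ^ 2 := by
  have h1 := abs_kl_sub_le hq hq1 hp1 hpq hη ht
  have h2 : |∑ a, q a * t a ^ 2| ≤ η ^ 2 :=
    abs_sum_mul_le hq hq1.le (by positivity) fun a => by
      rw [abs_pow]; gcongr; exact ht a
  rw [abs_le] at *
  constructor <;> nlinarith [sq_nonneg η]

/-- This is log x ≤ x - 1 at x = √(q/p). After summation over two laws of equal mass the terms p - q
cancel, and the squared Hellinger distance remains. -/
theorem sub_add_sq_sqrt_le {p q : ℝ} (hp : 0 ≤ p) (hq : 0 ≤ q) (hpq : q = 0 → p = 0) :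
    p - q + (√p - √q) ^ 2 ≤ p * Real.log (p / q) := by
  rcases hp.eq_or_lt with h | h
  · simp [← h, Real.sq_sqrt hq]
  have hq' : 0 < q := hq.lt_of_ne fun e => h.ne' (hpq e.symm)
  have h1 := Real.log_le_sub_one_of_pos (x := √(q / p)) (by positivity)
  rw [Real.log_sqrt (by positivity), Real.sqrt_div hq] at h1
  have h2 : Real.log (p / q) = -Real.log (q / p) := by rw [← Real.log_inv, inv_div]
  have h3 : √q / √p * p = √q * √p := by
    have := Real.mul_self_sqrt hp
    have h' : √p ≠ 0 := by positivity
    field_simp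
    rw [sq, this]
  have e : p - q + (√p - √q) ^ 2 = 2 * p - 2 * (√q * √p) := by
    have := Real.sq_sqrt hp
    have := Real.sq_sqrt hq
    linear_combination (Real.sq_sqrt hp) + (Real.sq_sqrt hq)
  rw [e, h2]
  nlinarith

theorem sum_sq_sqrt_sub_le_kl {p q : α → ℝ} (hp : ∀ a, 0 ≤ p a) (hq : ∀ a, 0 ≤ q a)
    (hsum : ∑ a, p a = ∑ a, q a) (hpq : ∀ a, q a = 0 → p a = 0) :
    ∑ a, (√(p a) - √(q a)) ^ 2 ≤ kl p q := by
  have : ∑ a, (√(p a) - √(q a)) ^ 2 = ∑ a, (p a - q a + (√(p a) - √(q a)) ^ 2) := by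
    rw [Finset.sum_add_distrib, Finset.sum_sub_distrib, hsum]; ring
  rw [this]
  exact Finset.sum_le_sum fun a _ => sub_add_sq_sqrt_le (hp a) (hq a) (hpq a)

theorem kl_nonneg {p q : α → ℝ} (hp : ∀ a, 0 ≤ p a) (hq : ∀ a, 0 ≤ q a)
    (hsum : ∑ a, p a = ∑ a, q a) (hpq : ∀ a, q a = 0 → p a = 0) : 0 ≤ kl p q :=
  (Finset.sum_nonneg fun _ _ => sq_nonneg _).trans (sum_sq_sqrt_sub_le_kl hp hq hsum hpq)

theorem abs_sub_le_of_kl_le {p q : α → ℝ} {δ : ℝ} (hp : ∀ a, 0 ≤ p a) (hq : ∀ a, 0 ≤ q a)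
    (hp1 : ∑ a, p a = 1) (hq1 : ∑ a, q a = 1) (hpq : ∀ a, q a = 0 → p a = 0)
    (h : kl p q ≤ δ) (a : α) : |p a - q a| ≤ 2 * √δ := by
  have h1 : (√(p a) - √(q a)) ^ 2 ≤ δ :=
    (Finset.single_le_sum (f := fun a => (√(p a) - √(q a)) ^ 2) (fun _ _ => sq_nonneg _)
      (Finset.mem_univ a)).trans
      ((sum_sq_sqrt_sub_le_kl hp hq (hp1.trans hq1.symm) hpq).trans h)
  have h2 : |√(p a) - √(q a)| ≤ √δ := Real.abs_le_sqrt h1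
  have hp' : √(p a) ≤ 1 := Real.sqrt_le_one.2
    (hp1 ▸ Finset.single_le_sum (fun a _ => hp a) (Finset.mem_univ a))
  have hq' : √(q a) ≤ 1 := Real.sqrt_le_one.2
    (hq1 ▸ Finset.single_le_sum (fun a _ => hq a) (Finset.mem_univ a))
  have e : p a - q a = (√(p a) + √(q a)) * (√(p a) - √(q a)) := by
    linear_combination -(Real.sq_sqrt (hp a)) + (Real.sq_sqrt (hq a))
  rw [e, abs_mul, abs_of_nonneg (by positivity)]
  gcongr
  linarith

end KL

theorem sum_fiber_mul {ι β : Type*} [Fintype ι] [Fintype β] [DecidableEq β] (π : ι → β)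
    (f : ι → ℝ) (g : β → ℝ) :
    ∑ b, (∑ x with π x = b, f x) * g b = ∑ x, f x * g (π x) := by
  rw [← Finset.sum_fiberwise Finset.univ π]
  refine Finset.sum_congr rfl fun b _ => ?_
  rw [Finset.sum_mul]
  refine Finset.sum_congr rfl fun x hx => ?_
  rw [(Finset.mem_filter.1 hx).2]

/-! ### Mutual information near a product law. -/

section Joint

variable {𝒰 : Type*} {β : Type*}

theorem marginalU_nonneg [Fintype β] {Q : 𝒰 × β → ℝ} (hQ : ∀ z, 0 ≤ Q z) (u : 𝒰) : 0 ≤ marginalU Q u :=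
  Finset.sum_nonneg fun _ _ => hQ _

theorem marginalX_nonneg [Fintype 𝒰] {Q : 𝒰 × β → ℝ} (hQ : ∀ z, 0 ≤ Q z) (x : β) : 0 ≤ marginalX Q x :=
  Finset.sum_nonneg fun _ _ => hQ _

theorem le_marginalU [Fintype β] {Q : 𝒰 × β → ℝ} (hQ : ∀ z, 0 ≤ Q z) (u : 𝒰) (x : β) :
    Q (u, x) ≤ marginalU Q u :=
  Finset.single_le_sum (f := fun x => Q (u, x)) (fun _ _ => hQ _) (Finset.mem_univ x)

theorem le_marginalX [Fintype 𝒰] {Q : 𝒰 × β → ℝ} (hQ : ∀ z, 0 ≤ Q z) (u : 𝒰) (x : β) :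
    Q (u, x) ≤ marginalX Q x :=
  Finset.single_le_sum (f := fun u => Q (u, x)) (fun _ _ => hQ _) (Finset.mem_univ u)

variable [Fintype 𝒰] [Fintype β]

theorem sum_marginalU (Q : 𝒰 × β → ℝ) : ∑ u, marginalU Q u = ∑ z, Q z := by
  rw [Fintype.sum_prod_type]; rfl

theorem sum_marginalX (Q : 𝒰 × β → ℝ) : ∑ x, marginalX Q x = ∑ z, Q z := by
  rw [Fintype.sum_prod_type_right]; rfl

theorem eq_zero_of_marginal_mul {Q : 𝒰 × β → ℝ} (hQ : ∀ z, 0 ≤ Q z) (z : 𝒰 × β)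
    (h : marginalU Q z.1 * marginalX Q z.2 = 0) : Q z = 0 := by
  rcases mul_eq_zero.1 h with h | h
  · exact le_antisymm (h ▸ le_marginalU hQ z.1 z.2) (hQ z)
  · exact le_antisymm (h ▸ le_marginalX hQ z.1 z.2) (hQ z)

theorem sum_prod_weight {a : 𝒰 → ℝ} {b : β → ℝ} (ha : ∑ u, a u = 1) (hb : ∑ x, b x = 1) :
    ∑ z : 𝒰 × β, a z.1 * b z.2 = 1 := by
  rw [Fintype.sum_prod_type]
  simp only [← Finset.mul_sum, hb, mul_one, ha]

/-- Local expansion of the mutual information around a product law whose factors are close to the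
marginals. -/
theorem abs_mutualInfo_sub_le {a : 𝒰 → ℝ} {b : β → ℝ} {Q ε : 𝒰 × β → ℝ} {η τ : ℝ}
    (ha : ∀ u, 0 ≤ a u) (hb : ∀ x, 0 ≤ b x) (ha1 : ∑ u, a u = 1) (hb1 : ∑ x, b x = 1)
    (hQ : ∀ z, Q z = a z.1 * b z.2 * (1 + ε z)) (hQ1 : ∑ z, Q z = 1)
    (hη : η ≤ 1 / 2) (hε : ∀ z, |ε z| ≤ η) (hτ : τ ≤ 1 / 2)
    (hU : ∀ u, |∑ x, b x * ε (u, x)| ≤ τ) (hX : ∀ x, |∑ u, a u * ε (u, x)| ≤ τ) :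
    |mutualInfo Q - (∑ z : 𝒰 × β, a z.1 * b z.2 * ε z ^ 2) / 2| ≤ 4 * η ^ 3 + 6 * τ ^ 2 := by
  have hMU : ∀ u, marginalU Q u = a u * (1 + ∑ x, b x * ε (u, x)) := fun u => by
    simp only [marginalU, hQ]
    simp only [mul_add, mul_one, Finset.sum_add_distrib, Finset.mul_sum]
    rw [← Finset.mul_sum, hb1, mul_one]
    simp only [mul_assoc]
  have hMX : ∀ x, marginalX Q x = b x * (1 + ∑ u, a u * ε (u, x)) := fun x => by
    simp only [marginalX, hQ]
    simp only [mul_add, mul_one, Finset.sum_add_distrib, Finset.mul_sum]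
    rw [← Finset.sum_mul, ha1, one_mul]
    congr 1
    exact Finset.sum_congr rfl fun u _ => by ring
  have h1 := abs_kl_sub_le (p := Q) (q := fun z => a z.1 * b z.2) (t := ε) (η := η)
    (fun z => mul_nonneg (ha _) (hb _)) (sum_prod_weight ha1 hb1) hQ1 hQ hη hε
  have h2 := abs_kl_le (p := marginalU Q) (q := a) ha ha1 ((sum_marginalU Q).trans hQ1) hMU hτ hU
  have h3 := abs_kl_le (p := marginalX Q) (q := b) hb hb1 ((sum_marginalX Q).trans hQ1) hMX hτ hX
  have hQ0 : ∀ z, 0 ≤ Q z := fun z => by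
    rw [hQ]
    have := (abs_le.1 (hε z)).1
    exact mul_nonneg (mul_nonneg (ha _) (hb _)) (by linarith)
  -- Since a and b need not be the marginals of Q, the divergence from a ⊗ b exceeds the mutual
  -- information by the divergences of the marginals from a and b. Each of these is at most 3τ².
  have e : mutualInfo Q = kl Q (fun z => a z.1 * b z.2) - kl (marginalU Q) a
      - kl (marginalX Q) b := by
    have e2 : kl (marginalU Q) a = ∑ z, Q z * Real.log (marginalU Q z.1 / a z.1) := by
      rw [Fintype.sum_prod_type]
      exact Finset.sum_congr rfl fun u _ => by
        dsimp only; rw [← Finset.sum_mul]; rfl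
    have e3 : kl (marginalX Q) b = ∑ z, Q z * Real.log (marginalX Q z.2 / b z.2) := by
      rw [Fintype.sum_prod_type_right]
      exact Finset.sum_congr rfl fun u _ => by
        dsimp only; rw [← Finset.sum_mul]; rfl
    rw [e2, e3, mutualInfo, kl, kl, ← Finset.sum_sub_distrib, ← Finset.sum_sub_distrib]
    refine Finset.sum_congr rfl fun z _ => ?_
    rcases (hQ0 z).eq_or_lt with h | h
    · simp [← h]
    have hu : 0 < marginalU Q z.1 := h.trans_le (le_marginalU hQ0 z.1 z.2)
    have hx : 0 < marginalX Q z.2 := h.trans_le (le_marginalX hQ0 z.1 z.2)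
    have hua : a z.1 ≠ 0 := fun h0 => by rw [hMU, h0] at hu; simp at hu
    have hxb : b z.2 ≠ 0 := fun h0 => by rw [hMX, h0] at hx; simp at hx
    rw [Real.log_div h.ne' (by positivity), Real.log_div h.ne' (mul_ne_zero hua hxb),
      Real.log_div hu.ne' hua, Real.log_div hx.ne' hxb, Real.log_mul hu.ne' hx.ne',
      Real.log_mul hua hxb]
    ring
  rw [e]
  rw [abs_le] at *
  constructor <;> linarith

end Joint

/-! ### Conditional means, the chain rule, and the local expansion of the reduction. -/

section Tuple

variable {d : ℕ} {X : Fin d → Type*} [∀ i, Fintype (X i)] [∀ i, DecidableEq (X i)]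

/-- The conditional mean of `g` given the value of the `i`-th coordinate. -/
def condMean (P : (∀ i, X i) → ℝ) (i : Fin d) (g : (∀ i, X i) → ℝ) (a : X i) : ℝ :=
  (∑ x with x i = a, P x * g x) / coordMarginal P i a

/-- The sum over the coordinates of the second moments of the conditional means of `g`. -/
def energy (P : (∀ i, X i) → ℝ) (g : (∀ i, X i) → ℝ) : ℝ :=
  ∑ i, ∑ a, coordMarginal P i a * condMean P i g a ^ 2

theorem sum_coordMarginal (P : (∀ i, X i) → ℝ) (i : Fin d) :
    ∑ a, coordMarginal P i a = ∑ x, P x :=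
  Finset.sum_fiberwise Finset.univ (fun x : ∀ i, X i => x i) P

theorem coordMarginal_nonneg {P : (∀ i, X i) → ℝ} (hP : ∀ x, 0 ≤ P x) (i : Fin d) (a : X i) :
    0 ≤ coordMarginal P i a := Finset.sum_nonneg fun _ _ => hP _

theorem le_coordMarginal {P : (∀ i, X i) → ℝ} (hP : ∀ x, 0 ≤ P x) (i : Fin d)
    (x : ∀ i, X i) : P x ≤ coordMarginal P i (x i) :=
  Finset.single_le_sum (f := P) (fun _ _ => hP _) (by simp)

theorem sum_coordMarginal_mul (P : (∀ i, X i) → ℝ) (i : Fin d) (g : X i → ℝ) :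
    ∑ a, coordMarginal P i a * g a = ∑ x, P x * g (x i) :=
  sum_fiber_mul (fun x : ∀ i, X i => x i) P g

theorem coordMarginal_mul_condMean {P : (∀ i, X i) → ℝ} {i : Fin d} {a : X i}
    (h : 0 < coordMarginal P i a) (g : (∀ i, X i) → ℝ) :
    coordMarginal P i a * condMean P i g a = ∑ x with x i = a, P x * g x :=
  mul_div_cancel₀ _ h.ne'

theorem abs_condMean_le {P : (∀ i, X i) → ℝ} (hP : ∀ x, 0 ≤ P x) {i : Fin d} {a : X i}
    (h : 0 < coordMarginal P i a) {g : (∀ i, X i) → ℝ} {c : ℝ} (hg : ∀ x, |g x| ≤ c) :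
    |condMean P i g a| ≤ c := by
  rw [condMean, abs_div, abs_of_pos h, div_le_iff₀ h, coordMarginal, Finset.mul_sum]
  refine (Finset.abs_sum_le_sum_abs _ _).trans (Finset.sum_le_sum fun x _ => ?_)
  rw [abs_mul, abs_of_nonneg (hP x), mul_comm]
  exact mul_le_mul_of_nonneg_right (hg x) (hP x)

variable {𝒰 : Type*}

/-- The law of `(U, X_i)` under a joint law of `(U, X^d)`. -/
def coordLaw (Q : 𝒰 × (∀ i, X i) → ℝ) (i : Fin d) (z : 𝒰 × X i) : ℝ :=
  ∑ x with x i = z.2, Q (z.1, x)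

theorem marginalU_coordLaw (Q : 𝒰 × (∀ i, X i) → ℝ) (i : Fin d) (u : 𝒰) :
    marginalU (coordLaw Q i) u = marginalU Q u :=
  Finset.sum_fiberwise Finset.univ (fun x : ∀ i, X i => x i) fun x => Q (u, x)

theorem marginalX_coordLaw [Fintype 𝒰] (Q : 𝒰 × (∀ i, X i) → ℝ) (i : Fin d) (a : X i) :
    marginalX (coordLaw Q i) a = coordMarginal (marginalX Q) i a := by
  simp only [marginalX, coordLaw, coordMarginal]
  exact Finset.sum_comm

theorem coordMarginal_condX (Q : 𝒰 × (∀ i, X i) → ℝ) (u : 𝒰) (i : Fin d) (a : X i) :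
    coordMarginal (condX Q u) i a = coordLaw Q i (u, a) / marginalU Q u := by
  simp only [coordMarginal, condX, coordLaw, Finset.sum_div]

variable [Fintype 𝒰]

/-- `L(X^d | U) = ∑ i, I(U; X_i) - I(U; X^d)`. -/
theorem reduction_eq {Q : 𝒰 × (∀ i, X i) → ℝ} (hQ : ∀ z, 0 ≤ Q z) :
    reduction Q = ∑ i, mutualInfo (coordLaw Q i) - mutualInfo Q := by
  have e1 : ∀ i, mutualInfo (coordLaw Q i) = ∑ z, Q z * Real.log
      (coordLaw Q i (z.1, z.2 i) /
        (marginalU Q z.1 * coordMarginal (marginalX Q) i (z.2 i))) := fun i => by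
    rw [mutualInfo, kl, Fintype.sum_prod_type, Fintype.sum_prod_type]
    refine Finset.sum_congr rfl fun u _ => ?_
    simp only [marginalU_coordLaw, marginalX_coordLaw]
    exact sum_fiber_mul (fun x : ∀ i, X i => x i) (fun x => Q (u, x)) fun a =>
      Real.log (coordLaw Q i (u, a) / (marginalU Q u * coordMarginal (marginalX Q) i a))
  have e2 : totalCorrelation (marginalX Q) = ∑ z, Q z * Real.log (marginalX Q z.2 /
      ∏ i, coordMarginal (marginalX Q) i (z.2 i)) := by
    rw [Fintype.sum_prod_type_right]
    exact Finset.sum_congr rfl fun x _ => by dsimp only; rw [← Finset.sum_mul]; rfl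
  have e3 : ∑ u, marginalU Q u * totalCorrelation (condX Q u) = ∑ z, Q z * Real.log
      ((Q z / marginalU Q z.1) / ∏ i, (coordLaw Q i (z.1, z.2 i) / marginalU Q z.1)) := by
    rw [Fintype.sum_prod_type]
    refine Finset.sum_congr rfl fun u _ => ?_
    simp only [totalCorrelation, kl, Finset.mul_sum, coordMarginal_condX]
    refine Finset.sum_congr rfl fun x _ => ?_
    rcases (marginalU_nonneg hQ u).eq_or_lt with h | h
    · have : Q (u, x) = 0 := le_antisymm (h ▸ le_marginalU hQ u x) (hQ _)
      simp [← h, this]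
    · simp only [condX]
      rw [← mul_assoc, mul_div_cancel₀ _ h.ne']
  -- Every term is now an average of a log-ratio under Q, so it suffices to compare logarithms at
  -- each point of positive mass.
  rw [reduction, e2, e3, mutualInfo, kl, Finset.sum_congr rfl fun i _ => e1 i, Finset.sum_comm,
    ← Finset.sum_sub_distrib, ← Finset.sum_sub_distrib]
  refine Finset.sum_congr rfl fun z _ => ?_
  rw [← Finset.mul_sum, ← mul_sub, ← mul_sub]
  rcases (hQ z).eq_or_lt with h | h
  · simp [← h]
  congr 1
  have hu : marginalU Q z.1 ≠ 0 := (h.trans_le (le_marginalU hQ z.1 z.2)).ne'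
  have hx : 0 < marginalX Q z.2 := h.trans_le (le_marginalX hQ z.1 z.2)
  have hm : ∀ i, coordMarginal (marginalX Q) i (z.2 i) ≠ 0 := fun i =>
    (hx.trans_le (le_coordMarginal (marginalX_nonneg hQ) i z.2)).ne'
  have hc : ∀ i, coordLaw Q i (z.1, z.2 i) ≠ 0 := fun i =>
    (h.trans_le (Finset.single_le_sum (f := fun x => Q (z.1, x)) (fun _ _ => hQ _)
      (by simp : z.2 ∈ Finset.univ.filter fun x : ∀ i, X i => x i = z.2 i))).ne'
  rw [Real.log_div hx.ne' (Finset.prod_ne_zero_iff.2 fun i _ => hm i),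
    Real.log_div (div_ne_zero h.ne' hu)
      (Finset.prod_ne_zero_iff.2 fun i _ => div_ne_zero (hc i) hu),
    Real.log_div h.ne' hu, Real.log_div h.ne' (mul_ne_zero hu hx.ne'), Real.log_mul hu hx.ne',
    Real.log_prod fun i _ => hm i, Real.log_prod fun i _ => div_ne_zero (hc i) hu]
  simp only [Real.log_div (hc _) hu, Real.log_div (hc _) (mul_ne_zero hu (hm _)),
    Real.log_mul hu (hm _), Finset.sum_sub_distrib, Finset.sum_add_distrib]
  ring

/-- Local expansion of the reduction around a product law whose factors are close to the
marginals. -/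
theorem abs_reduction_sub_le {a : 𝒰 → ℝ} {P : (∀ i, X i) → ℝ} {Q ε : 𝒰 × (∀ i, X i) → ℝ}
    {η τ : ℝ} (ha : ∀ u, 0 ≤ a u) (hP : ∀ x, 0 ≤ P x) (hpos : ∀ i a, 0 < coordMarginal P i a)
    (ha1 : ∑ u, a u = 1) (hP1 : ∑ x, P x = 1)
    (hQ : ∀ z, Q z = a z.1 * P z.2 * (1 + ε z)) (hQ1 : ∑ z, Q z = 1)
    (hη : η ≤ 1 / 2) (hε : ∀ z, |ε z| ≤ η) (hτ : τ ≤ 1 / 2)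
    (hU : ∀ u, |∑ x, P x * ε (u, x)| ≤ τ) (hX : ∀ x, |∑ u, a u * ε (u, x)| ≤ τ) :
    |reduction Q - (∑ u, a u * energy P (fun x => ε (u, x)) -
      ∑ z : 𝒰 × (∀ i, X i), a z.1 * P z.2 * ε z ^ 2) / 2| ≤ (d + 1) * (4 * η ^ 3 + 6 * τ ^ 2) := by
  have hQ0 : ∀ z, 0 ≤ Q z := fun z => by
    rw [hQ]
    have := (abs_le.1 (hε z)).1
    exact mul_nonneg (mul_nonneg (ha _) (hP _)) (by linarith)
  have h0 := abs_mutualInfo_sub_le ha hP ha1 hP1 hQ hQ1 hη hε hτ hU hX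
  -- The law of (U, X_i) has the same form, with ε replaced by its conditional mean. Averaging
  -- preserves both bounds η and τ. These d errors and that of I(U;X^d) make the factor d + 1.
  have hi : ∀ i, |mutualInfo (coordLaw Q i) - (∑ z : 𝒰 × X i, a z.1 * coordMarginal P i z.2 *
      condMean P i (fun x => ε (z.1, x)) z.2 ^ 2) / 2| ≤ 4 * η ^ 3 + 6 * τ ^ 2 := fun i => by
    refine abs_mutualInfo_sub_le (ε := fun z => condMean P i (fun x => ε (z.1, x)) z.2)
      ha (coordMarginal_nonneg hP i) ha1 ((sum_coordMarginal P i).trans hP1)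
      (fun z => ?_) ?_ hη (fun z => abs_condMean_le hP (hpos i z.2) fun x => hε _) hτ
      (fun u => ?_) fun b => ?_
    · rw [mul_assoc, mul_add, mul_one, coordMarginal_mul_condMean (hpos i _), coordMarginal,
        coordLaw, ← Finset.sum_add_distrib, Finset.mul_sum]
      exact Finset.sum_congr rfl fun x _ => by rw [hQ]; ring
    · rw [← sum_marginalU, Finset.sum_congr rfl fun u _ => marginalU_coordLaw Q i u,
        sum_marginalU, hQ1]
    · dsimp only
      rw [Finset.sum_congr rfl fun b _ => coordMarginal_mul_condMean (hpos i b) _,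
        Finset.sum_fiberwise Finset.univ (fun x : ∀ i, X i => x i)]
      exact hU u
    · have : ∑ u, a u * condMean P i (fun x => ε (u, x)) b
          = condMean P i (fun x => ∑ u, a u * ε (u, x)) b := by
        simp only [condMean, Finset.mul_sum, Finset.sum_div, mul_div_assoc']
        rw [Finset.sum_comm]
        exact Finset.sum_congr rfl fun x _ => Finset.sum_congr rfl fun u _ => by ring
      dsimp only
      rw [this]
      exact abs_condMean_le hP (hpos i b) hX
  have e : ∑ u, a u * energy P (fun x => ε (u, x)) = ∑ i, ∑ z : 𝒰 × X i,
      a z.1 * coordMarginal P i z.2 * condMean P i (fun x => ε (z.1, x)) z.2 ^ 2 := by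
    simp only [energy, Fintype.sum_prod_type, Finset.mul_sum]
    rw [Finset.sum_comm]
    exact Finset.sum_congr rfl fun i _ => Finset.sum_congr rfl fun u _ =>
      Finset.sum_congr rfl fun b _ => by ring
  rw [reduction_eq hQ0, e]
  have hs : |∑ i, (mutualInfo (coordLaw Q i) - (∑ z : 𝒰 × X i, a z.1 * coordMarginal P i z.2 *
      condMean P i (fun x => ε (z.1, x)) z.2 ^ 2) / 2)| ≤ d * (4 * η ^ 3 + 6 * τ ^ 2) := by
    refine (Finset.abs_sum_le_sum_abs _ _).trans ((Finset.sum_le_sum fun i _ => hi i).trans ?_)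
    rw [Finset.sum_const, Finset.card_univ, Fintype.card_fin, nsmul_eq_mul]
  rw [Finset.sum_sub_distrib, ← Finset.sum_div] at hs
  rw [abs_le] at *
  constructor <;> linarith

end Tuple

/-! ### Quadratic forms of symmetric matrices on orthogonal complements of eigenvectors. -/

section Hermitian

open Matrix

variable {n : Type*} [Fintype n] [DecidableEq n] {M : Matrix n n ℝ} (hM : M.IsHermitian)

/-- The coordinates of a vector in the eigenbasis of a symmetric matrix. -/
def eigenCoord (j : n) (φ : n → ℝ) : ℝ := (hM.eigenvectorBasis j).ofLp ⬝ᵥ φ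

theorem dotProduct_eq_sum_eigenCoord (φ χ : n → ℝ) :
    φ ⬝ᵥ χ = ∑ j, eigenCoord hM j φ * eigenCoord hM j χ := by
  have h := hM.eigenvectorBasis.sum_inner_mul_inner (WithLp.toLp 2 φ) (WithLp.toLp 2 χ)
  simp only [EuclideanSpace.inner_eq_star_dotProduct, star_trivial] at h
  rw [dotProduct_comm, ← h]
  exact Finset.sum_congr rfl fun j _ => by rw [eigenCoord, eigenCoord, dotProduct_comm χ]

theorem eigenCoord_mulVec (j : n) (φ : n → ℝ) :
    eigenCoord hM j (M *ᵥ φ) = hM.eigenvalues j * eigenCoord hM j φ := by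
  have ht : Mᵀ = M := by
    have := hM.eq
    rwa [conjTranspose_eq_transpose_of_trivial] at this
  rw [eigenCoord, dotProduct_mulVec, ← mulVec_transpose, ht, hM.mulVec_eigenvectorBasis,
    smul_dotProduct, smul_eq_mul, eigenCoord]

theorem dotProduct_mulVec_le_of_eigenCoord {κ : ℝ} {φ : n → ℝ}
    (h : ∀ j, eigenCoord hM j φ = 0 ∨ hM.eigenvalues j ≤ κ) :
    φ ⬝ᵥ M *ᵥ φ ≤ κ * (φ ⬝ᵥ φ) := by
  rw [dotProduct_eq_sum_eigenCoord hM, dotProduct_eq_sum_eigenCoord hM φ φ, Finset.mul_sum]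
  refine Finset.sum_le_sum fun j _ => ?_
  rw [eigenCoord_mulVec]
  rcases h j with h | h
  · simp [h]
  · nlinarith [mul_self_nonneg (eigenCoord hM j φ)]

theorem eigenCoord_eq_zero {v : n → ℝ} {μ : ℝ} (hv : M *ᵥ v = μ • v) {j : n}
    (hj : hM.eigenvalues j ≠ μ) : eigenCoord hM j v = 0 := by
  have h := eigenCoord_mulVec hM j v
  rw [hv, eigenCoord, dotProduct_smul, smul_eq_mul, ← eigenCoord] at h
  have : (μ - hM.eigenvalues j) * eigenCoord hM j v = 0 := by linarith
  rcases mul_eq_zero.1 this with h | h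
  · exact absurd (by linarith) hj
  · exact h

/-- If all eigenvalues but one are at most `κ`, then the quadratic form is at most `κ` on the
orthogonal complement of an eigenvector for an eigenvalue larger than `κ`. -/
theorem dotProduct_mulVec_le_of_orthogonal {v φ : n → ℝ} {μ κ : ℝ} {k : n}
    (hv : M *ᵥ v = μ • v) (hv1 : v ⬝ᵥ v = 1) (hκ : κ < μ)
    (hk : ∀ j, j ≠ k → hM.eigenvalues j ≤ κ) (hφ : v ⬝ᵥ φ = 0) :
    φ ⬝ᵥ M *ᵥ φ ≤ κ * (φ ⬝ᵥ φ) := by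
  -- Only the k-th coordinate of v survives, so v is a nonzero multiple of the k-th basis vector,
  -- and orthogonality to v kills the k-th coordinate of φ.
  have h0 : ∀ j, j ≠ k → eigenCoord hM j v = 0 := fun j hj =>
    eigenCoord_eq_zero hM hv ((hk j hj).trans_lt hκ).ne
  have hs : ∀ χ, v ⬝ᵥ χ = eigenCoord hM k v * eigenCoord hM k χ := fun χ => by
    rw [dotProduct_eq_sum_eigenCoord hM]
    exact Finset.sum_eq_single k (fun j _ hj => by rw [h0 j hj, zero_mul]) (by simp)
  refine dotProduct_mulVec_le_of_eigenCoord hM fun j => ?_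
  by_cases hj : j = k
  · left
    rw [hs] at hv1 hφ
    rw [hj]
    rcases mul_eq_zero.1 hφ with h | h
    · rw [h] at hv1; simp at hv1
    · exact h
  · exact Or.inr (hk j hj)

/-- If all eigenvalues but two are at most `κ`, then the quadratic form is at most `κ` on the
orthogonal complement of two orthonormal eigenvectors for eigenvalues larger than `κ`. -/
theorem dotProduct_mulVec_le_of_orthogonal₂ {v w φ : n → ℝ} {μ ν κ : ℝ} {k l : n} (hkl : k ≠ l)
    (hv : M *ᵥ v = μ • v) (hw : M *ᵥ w = ν • w) (hv1 : v ⬝ᵥ v = 1) (hw1 : w ⬝ᵥ w = 1)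
    (hvw : v ⬝ᵥ w = 0) (hμ : κ < μ) (hν : κ < ν)
    (hk : ∀ j, j ≠ k → j ≠ l → hM.eigenvalues j ≤ κ) (hvφ : v ⬝ᵥ φ = 0) (hwφ : w ⬝ᵥ φ = 0) :
    φ ⬝ᵥ M *ᵥ φ ≤ κ * (φ ⬝ᵥ φ) := by
  have hs : ∀ {v : n → ℝ} {μ : ℝ}, M *ᵥ v = μ • v → κ < μ → ∀ χ,
      v ⬝ᵥ χ = eigenCoord hM k v * eigenCoord hM k χ + eigenCoord hM l v * eigenCoord hM l χ := by
    intro v μ hv hκ χ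
    rw [dotProduct_eq_sum_eigenCoord hM, ← Finset.sum_pair
      (f := fun j => eigenCoord hM j v * eigenCoord hM j χ) hkl]
    refine (Finset.sum_subset (Finset.subset_univ _) fun j _ hj => ?_).symm
    simp only [Finset.mem_insert, Finset.mem_singleton, not_or] at hj
    rw [eigenCoord_eq_zero hM hv ((hk j hj.1 hj.2).trans_lt hκ).ne, zero_mul]
  rw [hs hv hμ] at hv1 hvw hvφ
  rw [hs hw hν] at hw1 hwφ
  generalize eigenCoord hM k v = a at *
  generalize eigenCoord hM l v = b at *
  generalize eigenCoord hM k w = c at *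
  generalize eigenCoord hM l w = e at *
  -- The coordinate vectors of v and w in the plane of the indices k, l are orthonormal, so their
  -- determinant is ±1. Orthogonality to v and w is then an invertible system, which kills both
  -- coordinates of φ.
  have hdet : (a * e - b * c) ^ 2 = 1 := by
    linear_combination (c * c + e * e) * hv1 + hw1 - (a * c + b * e) * hvw
  refine dotProduct_mulVec_le_of_eigenCoord hM fun j => ?_
  by_cases hj : j = k
  · left
    rw [hj]
    have : (a * e - b * c) * eigenCoord hM k φ = 0 := by linear_combination e * hvφ - b * hwφ
    rcases mul_eq_zero.1 this with h | h
    · rw [h] at hdet; norm_num at hdet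
    · exact h
  by_cases hj' : j = l
  · left
    rw [hj']
    have : (a * e - b * c) * eigenCoord hM l φ = 0 := by linear_combination a * hwφ - c * hvφ
    rcases mul_eq_zero.1 this with h | h
    · rw [h] at hdet; norm_num at hdet
    · exact h
  · exact Or.inr (hk j hj hj')

end Hermitian

/-! ### The matrix B as T T*, with T the scaled conditional means, and its spectral bounds. -/

section Tuple

open Matrix

variable {d : ℕ} {X : Fin d → Type*} [∀ i, Fintype (X i)] [∀ i, DecidableEq (X i)]
  {P : (∀ i, X i) → ℝ}

/-- The function `∑ i, f_i(x_i)` of `x`, where `f_i` is the feature of `φ`. -/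
def featureSum (P : (∀ i, X i) → ℝ) (φ : (Σ i, X i) → ℝ) (x : ∀ i, X i) : ℝ :=
  ∑ i, feature P φ i (x i)

theorem featureSum_psiZero (hpos : ∀ i a, 0 < coordMarginal P i a) (x : ∀ i, X i) :
    featureSum P (psiZero P) x = √d := by
  have : ∀ i, feature P (psiZero P) i (x i) = (√d)⁻¹ := fun i => by
    have := Real.sqrt_pos.2 (hpos i (x i))
    rw [feature, psiZero]
    field_simp
  rw [featureSum, Finset.sum_congr rfl fun i _ => this i]
  simp only [Finset.sum_const, Finset.card_univ, Fintype.card_fin, nsmul_eq_mul]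
  exact Real.div_sqrt

/-- The identity B = T T*: up to square-root weights, the block (i, j) of B is the conditional
expectation of a function of X_j given X_i. -/
theorem mulVec_pairwiseMatrix (hpos : ∀ i a, 0 < coordMarginal P i a) (φ : (Σ i, X i) → ℝ)
    (i : Fin d) (a : X i) : (pairwiseMatrix P *ᵥ φ) ⟨i, a⟩ =
      √(coordMarginal P i a) * condMean P i (featureSum P φ) a := by
  have hsq := Real.sqrt_pos.2 (hpos i a)
  have key : ∀ j, ∑ b, pairwiseMatrix P ⟨i, a⟩ ⟨j, b⟩ * φ ⟨j, b⟩ =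
      (∑ x with x i = a, P x * feature P φ j (x j)) / √(coordMarginal P i a) := by
    intro j
    rw [← Finset.sum_fiberwise _ (fun x : ∀ i, X i => x j), Finset.sum_div]
    refine Finset.sum_congr rfl fun b _ => ?_
    have e : ∑ x with x i = a ∧ x j = b, P x * feature P φ j (x j) =
        pairMarginal P i j a b * feature P φ j b := by
      rw [pairMarginal, Finset.sum_mul]
      exact Finset.sum_congr rfl fun x hx => by rw [(Finset.mem_filter.1 hx).2.2]
    rw [Finset.filter_filter, e, feature]
    have hb := Real.sqrt_pos.2 (hpos j b)
    -- The diagonal blocks obey the same formula as the others: the pair marginal of (X_i, X_i) is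
    -- supported on the diagonal, which normalizes to the identity.
    by_cases h : i = j
    · subst h
      by_cases hab : a = b
      · subst hab
        have : pairMarginal P i i a a = coordMarginal P i a := by
          simp only [pairMarginal, coordMarginal, and_self]
        rw [this]
        simp only [pairwiseMatrix, Matrix.of_apply, if_true]
        have h2 := Real.mul_self_sqrt (hpos i a).le
        field_simp
        rw [sq, h2]
      · have : pairMarginal P i i a b = 0 := by
          refine Finset.sum_eq_zero fun x hx => ?_
          have := (Finset.mem_filter.1 hx).2
          exact absurd (this.1.symm.trans this.2) hab
        rw [this]
        simp [pairwiseMatrix, hab]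
    · simp only [pairwiseMatrix, Matrix.of_apply, h, if_false]
      field_simp
  rw [mulVec, dotProduct, Fintype.sum_sigma, Finset.sum_congr rfl fun j _ => key j,
    ← Finset.sum_div, Finset.sum_comm, condMean]
  have h2 := Real.mul_self_sqrt (hpos i a).le
  simp only [← Finset.mul_sum, featureSum]
  nth_rw 3 [← h2]
  field_simp

/-- Adjointness of T and `featureSum`, by the tower property on each coordinate. -/
theorem sum_mul_sqrt_mul_condMean (hpos : ∀ i a, 0 < coordMarginal P i a)
    (φ : (Σ i, X i) → ℝ) (g : (∀ i, X i) → ℝ) :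
    ∑ p : Σ i, X i, φ p * (√(coordMarginal P p.1 p.2) * condMean P p.1 g p.2) =
      ∑ x, P x * (featureSum P φ x * g x) := by
  rw [Fintype.sum_sigma]
  have : ∀ i, ∑ a, φ ⟨i, a⟩ * (√(coordMarginal P i a) * condMean P i g a) =
      ∑ x, P x * g x * feature P φ i (x i) := fun i => by
    rw [← sum_fiber_mul (fun x : ∀ i, X i => x i)]
    refine Finset.sum_congr rfl fun a _ => ?_
    rw [← coordMarginal_mul_condMean (hpos i a), feature]
    have h := Real.sqrt_pos.2 (hpos i a)
    have h2 := Real.mul_self_sqrt (hpos i a).le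
    nth_rw 2 [← h2]
    field_simp
  rw [Finset.sum_congr rfl fun i _ => this i, Finset.sum_comm]
  refine Finset.sum_congr rfl fun x _ => ?_
  rw [← Finset.mul_sum, featureSum]
  ring

theorem dotProduct_pairwiseMatrix (hpos : ∀ i a, 0 < coordMarginal P i a)
    (φ χ : (Σ i, X i) → ℝ) : φ ⬝ᵥ pairwiseMatrix P *ᵥ χ =
      ∑ x, P x * (featureSum P φ x * featureSum P χ x) := by
  rw [← sum_mul_sqrt_mul_condMean hpos]
  exact Finset.sum_congr rfl fun p _ => by rw [mulVec_pairwiseMatrix hpos]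

theorem sum_mul_feature_sq (hpos : ∀ i a, 0 < coordMarginal P i a) (φ : (Σ i, X i) → ℝ)
    (i : Fin d) : ∑ x, P x * feature P φ i (x i) ^ 2 = ∑ a, φ ⟨i, a⟩ ^ 2 := by
  rw [← sum_coordMarginal_mul P i fun a => feature P φ i a ^ 2]
  refine Finset.sum_congr rfl fun a _ => ?_
  rw [feature, div_pow, Real.sq_sqrt (hpos i a).le, mul_div_cancel₀ _ (hpos i a).ne']

/-- Cauchy–Schwarz in the form (∑ f_i)² ≤ d ∑ f_i², averaged under P. It shows that d, attained at
`psiZero`, is the top eigenvalue. -/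
theorem dotProduct_pairwiseMatrix_le (hP : ∀ x, 0 ≤ P x)
    (hpos : ∀ i a, 0 < coordMarginal P i a) (φ : (Σ i, X i) → ℝ) :
    φ ⬝ᵥ pairwiseMatrix P *ᵥ φ ≤ d * (φ ⬝ᵥ φ) := by
  have e : φ ⬝ᵥ φ = ∑ x, P x * ∑ i, feature P φ i (x i) ^ 2 := by
    simp only [Finset.mul_sum]
    rw [Finset.sum_comm, Finset.sum_congr rfl fun i _ => sum_mul_feature_sq hpos φ i,
      dotProduct, Fintype.sum_sigma]
    simp only [sq]
  rw [dotProduct_pairwiseMatrix hpos, e, Finset.mul_sum]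
  refine Finset.sum_le_sum fun x _ => ?_
  have := sq_sum_le_card_mul_sum_sq (s := Finset.univ) (f := fun i => feature P φ i (x i))
  rw [Finset.card_univ, Fintype.card_fin] at this
  rw [featureSum, ← sq, mul_left_comm]
  exact mul_le_mul_of_nonneg_left this (hP x)

theorem pairwiseMatrix_mulVec_psiZero (hpos : ∀ i a, 0 < coordMarginal P i a) :
    pairwiseMatrix P *ᵥ psiZero P = (d : ℝ) • psiZero P := by
  ext ⟨i, a⟩
  rw [mulVec_pairwiseMatrix hpos, condMean]
  simp only [featureSum_psiZero hpos, ← Finset.sum_mul]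
  rw [← coordMarginal, mul_div_right_comm, div_self (hpos i a).ne', Pi.smul_apply, psiZero,
    smul_eq_mul, ← mul_assoc (d : ℝ), ← div_eq_mul_inv, Real.div_sqrt]
  ring

theorem psiZero_dotProduct_self (hP1 : ∑ x, P x = 1) (hP : ∀ x, 0 ≤ P x) (hd : d ≠ 0) :
    psiZero P ⬝ᵥ psiZero P = 1 := by
  rw [dotProduct, Fintype.sum_sigma]
  have : ∀ i, ∑ a, psiZero P ⟨i, a⟩ * psiZero P ⟨i, a⟩ = (d : ℝ)⁻¹ := fun i => by
    have h : ∀ a, psiZero P ⟨i, a⟩ * psiZero P ⟨i, a⟩ = (d : ℝ)⁻¹ * coordMarginal P i a :=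
      fun a => by
        rw [psiZero, mul_mul_mul_comm, ← mul_inv, Real.mul_self_sqrt d.cast_nonneg,
          Real.mul_self_sqrt (coordMarginal_nonneg hP i a)]
    rw [Finset.sum_congr rfl fun a _ => h a, ← Finset.mul_sum, sum_coordMarginal, hP1, mul_one]
  rw [Finset.sum_congr rfl fun i _ => this i]
  simp [hd]

/-- The adjoint of T sends `psiZero` to the constant √d, so the inner product is √d times the mean
of g. -/
theorem psiZero_dotProduct_condMean (hpos : ∀ i a, 0 < coordMarginal P i a)
    {g : (∀ i, X i) → ℝ} (hg : ∑ x, P x * g x = 0) :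
    psiZero P ⬝ᵥ (fun p => √(coordMarginal P p.1 p.2) * condMean P p.1 g p.2) = 0 := by
  rw [dotProduct, sum_mul_sqrt_mul_condMean hpos]
  simp only [featureSum_psiZero hpos, mul_left_comm _ (√(d : ℝ)), ← Finset.mul_sum, hg, mul_zero]

theorem energy_eq_sum (hP : ∀ x, 0 ≤ P x) (g : (∀ i, X i) → ℝ) :
    energy P g = ∑ p : Σ i, X i, (√(coordMarginal P p.1 p.2) * condMean P p.1 g p.2) ^ 2 := by
  rw [Fintype.sum_sigma]
  refine Finset.sum_congr rfl fun i _ => Finset.sum_congr rfl fun a _ => ?_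
  rw [mul_pow, Real.sq_sqrt (coordMarginal_nonneg hP i a)]

/-- A bound for the quadratic form of `B` at the vector of the scaled conditional means of `g`
carries over to the energy of `g`. -/
theorem energy_le_of_dotProduct_le (hP : ∀ x, 0 ≤ P x) (hpos : ∀ i a, 0 < coordMarginal P i a)
    {g : (∀ i, X i) → ℝ} {κ : ℝ} {φ : (Σ i, X i) → ℝ}
    (hφ : φ = fun p => √(coordMarginal P p.1 p.2) * condMean P p.1 g p.2)
    (h : φ ⬝ᵥ pairwiseMatrix P *ᵥ φ ≤ κ * (φ ⬝ᵥ φ)) :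
    energy P g ≤ max κ 0 * ∑ x, P x * g x ^ 2 := by
  have e1 : energy P g = φ ⬝ᵥ φ := by
    rw [energy_eq_sum hP, hφ]
    exact Finset.sum_congr rfl fun p _ => sq _
  have e2 : energy P g = ∑ x, P x * (featureSum P φ x * g x) := by
    rw [e1, ← sum_mul_sqrt_mul_condMean hpos, dotProduct]
    exact Finset.sum_congr rfl fun p _ => by rw [hφ]
  rw [dotProduct_pairwiseMatrix hpos, ← e1] at h
  have hE : 0 ≤ energy P g := e1 ▸ Finset.sum_nonneg fun p _ => mul_self_nonneg _
  have hG : 0 ≤ ∑ x, P x * g x ^ 2 := Finset.sum_nonneg fun x _ => mul_nonneg (hP x) (sq_nonneg _)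
  -- With φ = Tg, the energy is ‖φ‖² = ⟨T*φ, g⟩. Cauchy–Schwarz gives ‖φ‖⁴ ≤ ⟨φ, Bφ⟩ E[g²] ≤ κ ‖φ‖²
  -- E[g²], and one factor ‖φ‖² cancels. The maximum with 0 covers a negative κ when the energy is
  -- 0.
  have cs : (energy P g) ^ 2 ≤
      (∑ x, P x * (featureSum P φ x * featureSum P φ x)) * ∑ x, P x * g x ^ 2 := by
    rw [e2]
    refine Finset.sum_sq_le_sum_mul_sum_of_sq_le_mul _ (fun x _ => ?_) (fun x _ => ?_) fun x _ => ?_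
    · exact mul_nonneg (hP x) (mul_self_nonneg _)
    · exact mul_nonneg (hP x) (sq_nonneg _)
    · exact le_of_eq (by ring)
  rcases hE.eq_or_lt with h0 | h0
  · rw [← h0]; positivity
  have h3 : energy P g * energy P g ≤ (max κ 0 * ∑ x, P x * g x ^ 2) * energy P g := by
    calc _ = energy P g ^ 2 := (sq _).symm
      _ ≤ _ := cs
      _ ≤ (κ * energy P g) * ∑ x, P x * g x ^ 2 := mul_le_mul_of_nonneg_right h hG
      _ ≤ (max κ 0 * energy P g) * ∑ x, P x * g x ^ 2 := by
        gcongr; exact le_max_left _ _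
      _ = _ := by ring
  exact le_of_mul_le_mul_right h3 h0

theorem one_lt_card_sigma {ι : Type*} [Fintype ι] {Y : ι → Type*} [∀ i, Fintype (Y i)]
    (hY : ∃ i, Nontrivial (Y i)) : 1 < Fintype.card (Σ i, Y i) := by
  obtain ⟨i, hi⟩ := hY
  obtain ⟨a, b, hab⟩ := hi.exists_pair_ne
  exact Fintype.one_lt_card_iff.2 ⟨⟨i, a⟩, ⟨i, b⟩, fun h => hab (by simpa using h)⟩

/-- The index in position `k` in the decreasing order of the eigenvalues. -/
def eigenIndex (X : Fin d → Type*) [∀ i, Fintype (X i)] :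
    Fin (Fintype.card (Σ i, X i)) ≃ (Σ i, X i) :=
  Fintype.equivOfCardEq (Fintype.card_fin _)

/-- `eigenIndex` is the reindexing by which `eigenvalues` is defined from the sorted `eigenvalues₀`.
-/
theorem eigenvalues_le_eig {j : Σ i, X i} {k : ℕ} (hk : k ≤ (eigenIndex X).symm j) :
    (pairwiseMatrix_isHermitian P).eigenvalues j ≤ eig P k := by
  have hk' : k < Fintype.card (Σ i, X i) := hk.trans_lt ((eigenIndex X).symm j).2
  rw [eig, dif_pos hk']
  exact (pairwiseMatrix_isHermitian P).eigenvalues₀_antitone (Fin.mk_le_of_le_val hk)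

/-- If λ^{(1)} < d, then `psiZero` has a simple eigenvalue and its complement sees only the rest of
the spectrum. Otherwise `psiZero` need not be parallel to the first basis vector, but the crude
bound d suffices. -/
theorem dotProduct_pairwiseMatrix_le_eig_one (hP : ∀ x, 0 ≤ P x) (hP1 : ∑ x, P x = 1)
    (hpos : ∀ i a, 0 < coordMarginal P i a) (hX : ∃ i, Nontrivial (X i)) {φ : (Σ i, X i) → ℝ}
    (hφ : psiZero P ⬝ᵥ φ = 0) : φ ⬝ᵥ pairwiseMatrix P *ᵥ φ ≤ eig P 1 * (φ ⬝ᵥ φ) := by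
  rcases le_or_gt (d : ℝ) (eig P 1) with h | h
  · exact (dotProduct_pairwiseMatrix_le hP hpos φ).trans
      (mul_le_mul_of_nonneg_right h (Finset.sum_nonneg fun _ _ => mul_self_nonneg _))
  have hd : d ≠ 0 := by
    obtain ⟨i, -⟩ := hX
    exact (Fin.pos i).ne'
  refine dotProduct_mulVec_le_of_orthogonal (pairwiseMatrix_isHermitian P)
    (k := eigenIndex X ⟨0, zero_lt_one.trans (one_lt_card_sigma hX)⟩)
    (pairwiseMatrix_mulVec_psiZero hpos) (psiZero_dotProduct_self hP1 hP hd) h (fun j hj => ?_) hφ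
  refine eigenvalues_le_eig (Nat.one_le_iff_ne_zero.2 fun h0 => hj ?_)
  rw [← Equiv.symm_apply_eq]
  exact Fin.ext h0

theorem one_le_eig_one (hP : ∀ x, 0 ≤ P x) (hP1 : ∑ x, P x = 1)
    (hpos : ∀ i a, 0 < coordMarginal P i a) (hX : ∃ i, Nontrivial (X i)) : 1 ≤ eig P 1 := by
  obtain ⟨i, hi⟩ := id hX
  obtain ⟨a, b, hab⟩ := hi.exists_pair_ne
  have hne : (⟨i, a⟩ : Σ i, X i) ≠ ⟨i, b⟩ := fun h => hab (by simpa using h)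
  set α := √(coordMarginal P i a)
  set β := √(coordMarginal P i b)
  have hα : 0 < α := Real.sqrt_pos.2 (hpos i a)
  have hβ : 0 < β := Real.sqrt_pos.2 (hpos i b)
  -- A vector supported on two symbols of one alphabet and orthogonal to `psiZero`: the diagonal
  -- block is the identity, so its Rayleigh quotient is 1.
  have h := dotProduct_pairwiseMatrix_le_eig_one hP hP1 hpos hX
    (φ := Pi.single ⟨i, a⟩ β - Pi.single ⟨i, b⟩ α) (by
      rw [dotProduct_sub, dotProduct_single, dotProduct_single, psiZero, psiZero]
      ring)
  have e1 : (Pi.single ⟨i, a⟩ β - Pi.single ⟨i, b⟩ α : (Σ i, X i) → ℝ) ⬝ᵥ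
      (Pi.single ⟨i, a⟩ β - Pi.single ⟨i, b⟩ α) = α ^ 2 + β ^ 2 := by
    simp only [sub_dotProduct, single_dotProduct, Pi.sub_apply, Pi.single_eq_same,
      Pi.single_eq_of_ne hne, Pi.single_eq_of_ne hne.symm]
    ring
  have e2 : (Pi.single ⟨i, a⟩ β - Pi.single ⟨i, b⟩ α : (Σ i, X i) → ℝ) ⬝ᵥ pairwiseMatrix P *ᵥ
      (Pi.single ⟨i, a⟩ β - Pi.single ⟨i, b⟩ α) = α ^ 2 + β ^ 2 := by
    simp only [mulVec_sub, sub_dotProduct, dotProduct_sub, single_dotProduct,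
      Matrix.mulVec_single, Pi.smul_apply, Matrix.col_apply, pairwiseMatrix, Matrix.of_apply,
      if_true, hne, hne.symm, if_false, MulOpposite.smul_eq_mul_unop, MulOpposite.unop_op]
    ring
  rw [e1, e2] at h
  have : 0 < α ^ 2 + β ^ 2 := by positivity
  nlinarith

namespace IsSecondEigenvector

variable {ψ : (Σ i, X i) → ℝ}

theorem dotProduct_self (hψ : IsSecondEigenvector P ψ) : ψ ⬝ᵥ ψ = 1 := by
  rw [← hψ.unit]
  exact Finset.sum_congr rfl fun p _ => (sq _).symm

theorem dotProduct_pairwiseMatrix_le (hψ : IsSecondEigenvector P ψ) (hP : ∀ x, 0 ≤ P x)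
    (hP1 : ∑ x, P x = 1) (hpos : ∀ i a, 0 < coordMarginal P i a) (hX : ∃ i, Nontrivial (X i))
    {κ : ℝ} (h2 : eig P 2 ≤ κ) (h1 : κ < eig P 1) {φ : (Σ i, X i) → ℝ}
    (hφ : psiZero P ⬝ᵥ φ = 0) (hψφ : ψ ⬝ᵥ φ = 0) :
    φ ⬝ᵥ pairwiseMatrix P *ᵥ φ ≤ κ * (φ ⬝ᵥ φ) := by
  have hd : d ≠ 0 := by
    obtain ⟨i, -⟩ := hX
    exact (Fin.pos i).ne'
  -- Ensures that the eigenvalue d of `psiZero` also exceeds κ, so that both eigenvectors lie in the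
  -- plane of the first two basis vectors.
  have hle : eig P 1 ≤ d := by
    have := TotalCorr.dotProduct_pairwiseMatrix_le hP hpos ψ
    rwa [hψ.eigen, dotProduct_smul, hψ.dotProduct_self, smul_eq_mul, mul_one, mul_one] at this
  refine dotProduct_mulVec_le_of_orthogonal₂ (pairwiseMatrix_isHermitian P)
    (k := eigenIndex X ⟨0, zero_lt_one.trans (one_lt_card_sigma hX)⟩)
    (l := eigenIndex X ⟨1, one_lt_card_sigma hX⟩) (by simp)
    (pairwiseMatrix_mulVec_psiZero hpos) hψ.eigen (psiZero_dotProduct_self hP1 hP hd)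
    hψ.dotProduct_self hψ.orthogonal (h1.trans_le hle) h1 (fun j hj0 hj1 => ?_) hφ hψφ
  refine (eigenvalues_le_eig ((Nat.two_le_iff _).2 ⟨fun h0 => hj0 ?_, fun h0 => hj1 ?_⟩)).trans h2
  all_goals
    rw [← Equiv.symm_apply_eq]
    exact Fin.ext h0

/-- The eigenvector equation Bψ = λ^{(1)}ψ, read through B = T T*. -/
theorem condMean_featureSum (hψ : IsSecondEigenvector P ψ)
    (hpos : ∀ i a, 0 < coordMarginal P i a) (i : Fin d) (a : X i) :
    condMean P i (featureSum P ψ) a = eig P 1 * feature P ψ i a := by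
  have h := mulVec_pairwiseMatrix hpos ψ i a
  have hs := Real.sqrt_pos.2 (hpos i a)
  rw [hψ.eigen, Pi.smul_apply, smul_eq_mul] at h
  rw [feature]
  field_simp
  linarith

theorem sum_featureSum_eq_zero (hψ : IsSecondEigenvector P ψ)
    (hpos : ∀ i a, 0 < coordMarginal P i a) : ∑ x, P x * featureSum P ψ x = 0 := by
  have h : ψ ⬝ᵥ pairwiseMatrix P *ᵥ psiZero P = 0 := by
    rw [pairwiseMatrix_mulVec_psiZero hpos, dotProduct_smul, dotProduct_comm]
    exact (congrArg _ hψ.orthogonal).trans (smul_zero _)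
  rw [dotProduct_pairwiseMatrix hpos] at h
  simp only [featureSum_psiZero hpos, ← mul_assoc, ← Finset.sum_mul] at h
  rcases mul_eq_zero.1 h with h | h
  · exact h
  · have hd : d = 0 := by simpa using h
    subst hd
    simp [featureSum]

theorem sum_featureSum_sq (hψ : IsSecondEigenvector P ψ)
    (hpos : ∀ i a, 0 < coordMarginal P i a) : ∑ x, P x * featureSum P ψ x ^ 2 = eig P 1 := by
  have h := dotProduct_pairwiseMatrix hpos ψ ψ
  rw [hψ.eigen, dotProduct_smul, hψ.dotProduct_self, smul_eq_mul, mul_one] at h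
  rw [h]
  simp only [sq]

/-- The energy is additive along the orthogonal decomposition given by the feature sum of `ψ`. -/
theorem energy_add (hψ : IsSecondEigenvector P ψ) (hP : ∀ x, 0 ≤ P x)
    (hpos : ∀ i a, 0 < coordMarginal P i a) (c : ℝ) {g : (∀ i, X i) → ℝ}
    (hg : ∑ x, P x * (featureSum P ψ x * g x) = 0) :
    energy P (fun x => c * featureSum P ψ x + g x) = c ^ 2 * eig P 1 ^ 2 + energy P g := by
  have hc : ∀ i a, condMean P i (fun x => c * featureSum P ψ x + g x) a
      = c * (eig P 1 * feature P ψ i a) + condMean P i g a := fun i a => by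
    rw [← hψ.condMean_featureSum hpos, condMean, condMean, condMean, mul_div_assoc', ← add_div,
      Finset.mul_sum, ← Finset.sum_add_distrib]
    congr 1
    exact Finset.sum_congr rfl fun x _ => by ring
  rw [energy_eq_sum hP, energy_eq_sum hP]
  -- T maps the feature sum of ψ to λ^{(1)}ψ. By adjointness the cross term is a multiple of E[F g],
  -- which is 0.
  have hterm : ∀ p : Σ i, X i, (√(coordMarginal P p.1 p.2) *
      condMean P p.1 (fun x => c * featureSum P ψ x + g x) p.2) ^ 2 =
      c ^ 2 * eig P 1 ^ 2 * ψ p ^ 2 + 2 * c * eig P 1 * (ψ p *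
        (√(coordMarginal P p.1 p.2) * condMean P p.1 g p.2)) +
      (√(coordMarginal P p.1 p.2) * condMean P p.1 g p.2) ^ 2 := fun ⟨i, a⟩ => by
    have h := Real.sqrt_pos.2 (hpos i a)
    rw [hc, feature]
    field_simp
    ring
  rw [Finset.sum_congr rfl fun p _ => hterm p, Finset.sum_add_distrib, Finset.sum_add_distrib,
    ← Finset.mul_sum, ← Finset.mul_sum, hψ.unit, sum_mul_sqrt_mul_condMean hpos, hg]
  ring

/-- Orthogonality of g to the constants and to F makes Tg orthogonal to `psiZero` and ψ, so the
spectral gap improves the constant from λ^{(1)} to κ. -/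
theorem energy_le (hψ : IsSecondEigenvector P ψ) (hP : ∀ x, 0 ≤ P x) (hP1 : ∑ x, P x = 1)
    (hpos : ∀ i a, 0 < coordMarginal P i a) (hX : ∃ i, Nontrivial (X i)) {κ : ℝ}
    (h2 : eig P 2 ≤ κ) (h1 : κ < eig P 1) {g : (∀ i, X i) → ℝ} (hg : ∑ x, P x * g x = 0)
    (hg' : ∑ x, P x * (featureSum P ψ x * g x) = 0) :
    energy P g ≤ max κ 0 * ∑ x, P x * g x ^ 2 := by
  refine energy_le_of_dotProduct_le hP hpos rfl (hψ.dotProduct_pairwiseMatrix_le hP hP1 hpos hX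
    h2 h1 (psiZero_dotProduct_condMean hpos hg) ?_)
  rw [dotProduct, sum_mul_sqrt_mul_condMean hpos, hg']

end IsSecondEigenvector

theorem energy_le_eig_one (hP : ∀ x, 0 ≤ P x) (hP1 : ∑ x, P x = 1)
    (hpos : ∀ i a, 0 < coordMarginal P i a) (hX : ∃ i, Nontrivial (X i))
    {g : (∀ i, X i) → ℝ} (hg : ∑ x, P x * g x = 0) :
    energy P g ≤ eig P 1 * ∑ x, P x * g x ^ 2 := by
  have h := energy_le_of_dotProduct_le hP hpos rfl
    (dotProduct_pairwiseMatrix_le_eig_one hP hP1 hpos hX (psiZero_dotProduct_condMean hpos hg))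
  rwa [max_eq_left (zero_le_one.trans (one_le_eig_one hP hP1 hpos hX))] at h

end Tuple

/-! ### The direction of the exponential family and expansions along it. -/

section Tilt

variable {d : ℕ} {X : Fin d → Type*} [∀ i, Fintype (X i)] [∀ i, DecidableEq (X i)]
  {P : (∀ i, X i) → ℝ} {ψ : (Σ i, X i) → ℝ}

theorem condMean_sub (P : (∀ i, X i) → ℝ) (i : Fin d) (g g' : (∀ i, X i) → ℝ) (a : X i) :
    condMean P i g a - condMean P i g' a = condMean P i (fun x => g x - g' x) a := by
  simp only [condMean, mul_sub, Finset.sum_sub_distrib, sub_div]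

theorem abs_sq_sub_sq_le {x y c r : ℝ} (hy : |y| ≤ c) (hxy : |x - y| ≤ r) :
    |x ^ 2 - y ^ 2| ≤ r * (2 * c + r) := by
  have e : x ^ 2 - y ^ 2 = (x - y) * (2 * y + (x - y)) := by ring
  rw [e, abs_mul]
  have h : |2 * y + (x - y)| ≤ 2 * c + r := by
    refine (abs_add_le _ _).trans ?_
    rw [abs_mul, abs_two]
    gcongr
  have hr := (abs_nonneg _).trans hxy
  gcongr

theorem abs_energy_sub_le (hP : ∀ x, 0 ≤ P x) (hP1 : ∑ x, P x = 1)
    (hpos : ∀ i a, 0 < coordMarginal P i a) {g g' : (∀ i, X i) → ℝ} {c r : ℝ} (hc : 0 ≤ c)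
    (hr : 0 ≤ r) (hg' : ∀ x, |g' x| ≤ c) (hgg' : ∀ x, |g x - g' x| ≤ r) :
    |energy P g - energy P g'| ≤ d * (r * (2 * c + r)) := by
  rw [energy, energy, ← Finset.sum_sub_distrib]
  have : ∀ i, |∑ a, coordMarginal P i a * condMean P i g a ^ 2 -
      ∑ a, coordMarginal P i a * condMean P i g' a ^ 2| ≤ r * (2 * c + r) := fun i => by
    simp only [← Finset.sum_sub_distrib, ← mul_sub]
    refine abs_sum_mul_le (fun a => (hpos i a).le) ((sum_coordMarginal P i).trans hP1).le
      (by positivity) fun a => abs_sq_sub_sq_le (abs_condMean_le hP (hpos i a) hg') ?_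
    rw [condMean_sub]
    exact abs_condMean_le hP (hpos i a) hgg'
  refine (Finset.abs_sum_le_sum_abs _ _).trans ((Finset.sum_le_sum fun i _ => this i).trans ?_)
  rw [Finset.sum_const, Finset.card_univ, Fintype.card_fin, nsmul_eq_mul]

variable {𝒰 : Type*}

/-- The direction `h(u) / √λ^{(1)} ∑ i, f_i(x_i)` of the exponential family. -/
def tilt (P : (∀ i, X i) → ℝ) (ψ : (Σ i, X i) → ℝ) (h : 𝒰 → ℝ) (z : 𝒰 × (∀ i, X i)) : ℝ :=
  h z.1 / √(eig P 1) * featureSum P ψ z.2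

theorem sum_mul_tilt_right (hψ : IsSecondEigenvector P ψ)
    (hpos : ∀ i a, 0 < coordMarginal P i a) (h : 𝒰 → ℝ) (u : 𝒰) :
    ∑ x, P x * tilt P ψ h (u, x) = 0 := by
  simp only [tilt, mul_left_comm (P _)]
  rw [← Finset.mul_sum, hψ.sum_featureSum_eq_zero hpos, mul_zero]

variable [Fintype 𝒰] {PU : 𝒰 → ℝ} {h : 𝒰 → ℝ}

theorem sum_mul_tilt_left (hh : h ∈ unitFunctions PU) (x : ∀ i, X i) :
    ∑ u, PU u * tilt P ψ h (u, x) = 0 := by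
  have : ∀ u, PU u * tilt P ψ h (u, x) = PU u * h u * (featureSum P ψ x / √(eig P 1)) :=
    fun u => by rw [tilt]; ring
  rw [Finset.sum_congr rfl fun u _ => this u, ← Finset.sum_mul, hh.1, zero_mul]

theorem sum_mul_tilt_sq (hψ : IsSecondEigenvector P ψ) (hpos : ∀ i a, 0 < coordMarginal P i a)
    (hev : 0 < eig P 1) (hh : h ∈ unitFunctions PU) :
    ∑ z : 𝒰 × (∀ i, X i), PU z.1 * P z.2 * tilt P ψ h z ^ 2 = 1 := by
  have : ∀ z : 𝒰 × (∀ i, X i), PU z.1 * P z.2 * tilt P ψ h z ^ 2 =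
      (PU z.1 * h z.1 ^ 2) * (P z.2 * featureSum P ψ z.2 ^ 2 / eig P 1) := fun z => by
    rw [tilt, mul_pow, div_pow, Real.sq_sqrt hev.le]; ring
  rw [Finset.sum_congr rfl fun z _ => this z, Fintype.sum_prod_type]
  simp only [← Finset.mul_sum, ← Finset.sum_div, hψ.sum_featureSum_sq hpos, div_self hev.ne',
    mul_one]
  exact hh.2

theorem sum_mul_energy_tilt (hψ : IsSecondEigenvector P ψ) (hP : ∀ x, 0 ≤ P x)
    (hpos : ∀ i a, 0 < coordMarginal P i a) (hev : 0 < eig P 1) (hh : h ∈ unitFunctions PU)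
    (s : ℝ) : ∑ u, PU u * energy P (fun x => s * tilt P ψ h (u, x)) = s ^ 2 * eig P 1 := by
  have : ∀ u, energy P (fun x => s * tilt P ψ h (u, x)) = h u ^ 2 * (s ^ 2 * eig P 1) :=
    fun u => by
      have h0 := hψ.energy_add hP hpos (s * (h u / √(eig P 1))) (g := fun _ => 0) (by simp)
      have h1 : energy P (fun _ => 0) = 0 := by simp [energy, condMean]
      rw [h1, mul_pow, div_pow, Real.sq_sqrt hev.le] at h0
      simp only [tilt, ← mul_assoc]
      simp only [add_zero] at h0
      rw [h0]
      field_simp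
  simp only [this, ← mul_assoc, ← Finset.sum_mul]
  rw [hh.2, one_mul]

/-- Mutual information and reduction of a perturbation of a product law along the direction of the
exponential family. -/
theorem abs_sub_le_of_tilt (hψ : IsSecondEigenvector P ψ) (hP : ∀ x, 0 ≤ P x)
    (hP1 : ∑ x, P x = 1) (hpos : ∀ i a, 0 < coordMarginal P i a) (hev : 0 < eig P 1)
    (hPU : ∀ u, 0 ≤ PU u) (hPU1 : ∑ u, PU u = 1) (hh : h ∈ unitFunctions PU)
    {Q ρ : 𝒰 × (∀ i, X i) → ℝ} {s κ : ℝ} (hκ0 : 0 ≤ κ) (hκ : κ ≤ 1 / 12)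
    (hs : ∀ z, |s * tilt P ψ h z| ≤ κ) (hρ : ∀ z, |ρ z| ≤ 6 * κ ^ 2)
    (hQ : ∀ z, Q z = PU z.1 * P z.2 * (1 + (s * tilt P ψ h z + ρ z))) (hQ1 : ∑ z, Q z = 1) :
    |mutualInfo Q - s ^ 2 / 2| ≤ 40 * κ ^ 3 ∧
      |reduction Q - s ^ 2 / 2 * (eig P 1 - 1)| ≤ (d + 1) * (40 * κ ^ 3) := by
  have hr : 6 * κ ^ 2 ≤ κ / 2 := by nlinarith
  have hε : ∀ z, |s * tilt P ψ h z + ρ z| ≤ 3 / 2 * κ := fun z =>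
    (abs_add_le _ _).trans (by linarith [hs z, hρ z])
  -- The tilt is centred in each variable separately, so only ρ moves the marginals. They change by
  -- O(κ²), at a cost of order κ⁴.
  have hU : ∀ u, |∑ x, P x * (s * tilt P ψ h (u, x) + ρ (u, x))| ≤ 6 * κ ^ 2 := fun u => by
    simp only [mul_add, Finset.sum_add_distrib, mul_left_comm _ s, ← Finset.mul_sum]
    rw [sum_mul_tilt_right hψ hpos, mul_zero, zero_add]
    exact abs_sum_mul_le hP hP1.le (by positivity) fun x => hρ _
  have hX : ∀ x, |∑ u, PU u * (s * tilt P ψ h (u, x) + ρ (u, x))| ≤ 6 * κ ^ 2 := fun x => by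
    simp only [mul_add, Finset.sum_add_distrib, mul_left_comm _ s, ← Finset.mul_sum]
    rw [sum_mul_tilt_left hh, mul_zero, zero_add]
    exact abs_sum_mul_le hPU hPU1.le (by positivity) fun x => hρ _
  have h1 := abs_mutualInfo_sub_le hPU hP hPU1 hP1 hQ hQ1 (by linarith) hε (by linarith) hU hX
  have h2 := abs_reduction_sub_le hPU hP hpos hPU1 hP1 hQ hQ1 (by linarith) hε (by linarith) hU hX
  have hb : 6 * κ ^ 2 * (2 * κ + 6 * κ ^ 2) ≤ 15 * κ ^ 3 := by
    have : 2 * κ + 6 * κ ^ 2 ≤ 5 / 2 * κ := by linarith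
    nlinarith [mul_le_mul_of_nonneg_left this (by positivity : 0 ≤ 6 * κ ^ 2)]
  have h3 : |∑ z : 𝒰 × (∀ i, X i), PU z.1 * P z.2 * (s * tilt P ψ h z + ρ z) ^ 2 - s ^ 2|
      ≤ 15 * κ ^ 3 := by
    have e : s ^ 2 = ∑ z : 𝒰 × (∀ i, X i), PU z.1 * P z.2 * (s * tilt P ψ h z) ^ 2 := by
      simp only [mul_pow, mul_left_comm _ (s ^ 2), ← Finset.mul_sum]
      rw [sum_mul_tilt_sq hψ hpos hev hh, mul_one]
    rw [e, ← Finset.sum_sub_distrib]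
    simp only [← mul_sub]
    refine (abs_sum_mul_le (fun z => mul_nonneg (hPU _) (hP _)) (sum_prod_weight hPU1 hP1).le
      (by positivity) fun z => abs_sq_sub_sq_le (hs z) ?_).trans hb
    rw [add_sub_cancel_left]
    exact hρ z
  have h4 : |∑ u, PU u * energy P (fun x => s * tilt P ψ h (u, x) + ρ (u, x)) -
      s ^ 2 * eig P 1| ≤ d * (15 * κ ^ 3) := by
    rw [← sum_mul_energy_tilt hψ hP hpos hev hh, ← Finset.sum_sub_distrib]
    simp only [← mul_sub]
    refine (abs_sum_mul_le hPU hPU1.le (by positivity) fun u =>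
      abs_energy_sub_le hP hP1 hpos hκ0 (by positivity) (fun x => hs (u, x)) fun x => ?_).trans
      (mul_le_mul_of_nonneg_left hb d.cast_nonneg)
    rw [add_sub_cancel_left]
    exact hρ (u, x)
  -- Together with half of the 15κ³ from `h3` and `h4` this makes 39κ³ per term, rounded up to 40κ³.
  have h5 : 4 * (3 / 2 * κ) ^ 3 + 6 * (6 * κ ^ 2) ^ 2 ≤ 63 / 2 * κ ^ 3 := by
    have : κ ^ 4 ≤ κ ^ 3 * (1 / 12) := by
      rw [pow_succ]; gcongr
    nlinarith
  have h6 := mul_le_mul_of_nonneg_left h5 (by positivity : (0 : ℝ) ≤ d + 1)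
  have h7 : (0 : ℝ) ≤ d * κ ^ 3 := by positivity
  have h8 : 0 ≤ κ ^ 3 := by positivity
  rw [abs_le] at h1 h2 h3 h4
  rw [abs_le, abs_le]
  refine ⟨⟨?_, ?_⟩, ?_, ?_⟩ <;> nlinarith

theorem unitFunctions_nonempty [Nontrivial 𝒰] (hPU : ∀ u, 0 < PU u) :
    (unitFunctions PU).Nonempty := by
  classical
  obtain ⟨a, b, hab⟩ := exists_pair_ne 𝒰
  have ha := hPU a
  have hb := hPU b
  -- A function supported on two points, centred by swapping their masses; c² is its variance before
  -- normalization.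
  have hc : 0 < √(PU a * PU b * (PU a + PU b)) := by positivity
  have hc2 := Real.mul_self_sqrt (by positivity : 0 ≤ PU a * PU b * (PU a + PU b))
  set c := √(PU a * PU b * (PU a + PU b))
  refine ⟨fun u => ((Pi.single a (PU b) : 𝒰 → ℝ) u - (Pi.single b (PU a) : 𝒰 → ℝ) u) / c, ?_, ?_⟩
  · have : ∀ u, PU u * (((Pi.single a (PU b) : 𝒰 → ℝ) u - (Pi.single b (PU a) : 𝒰 → ℝ) u) / c) =
        (Pi.single a (PU a * PU b / c) : 𝒰 → ℝ) u - (Pi.single b (PU a * PU b / c) : 𝒰 → ℝ) u := fun u => by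
      rcases eq_or_ne u a with rfl | h
      · simp [hab, mul_div_assoc]
      rcases eq_or_ne u b with rfl | h'
      · simp [h]; ring
      · simp [h, h']
    simp [this]
  · have : ∀ u, PU u * (((Pi.single a (PU b) : 𝒰 → ℝ) u - (Pi.single b (PU a) : 𝒰 → ℝ) u) / c) ^ 2 =
        (Pi.single a (PU a * PU b ^ 2 / c ^ 2) : 𝒰 → ℝ) u +
          (Pi.single b (PU b * PU a ^ 2 / c ^ 2) : 𝒰 → ℝ) u := fun u => by
      rcases eq_or_ne u a with rfl | h
      · simp [hab]; ring
      rcases eq_or_ne u b with rfl | h'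
      · simp [h]; ring
      · simp [h, h']
    simp only [this, Finset.sum_add_distrib, Finset.sum_pi_single', Finset.mem_univ, if_true]
    rw [← add_div, sq c, hc2]
    field_simp
    ring

/-- Unit variance and P_U > γ force |h| ≤ γ^{-1/2}. This makes all later constants independent of
P_U and h. -/
theorem abs_tilt_le {γ : ℝ} (hγ : 0 < γ) (hPU : ∀ u, γ < PU u) (hev : 1 ≤ eig P 1)
    (hh : h ∈ unitFunctions PU) (z : 𝒰 × (∀ i, X i)) :
    |tilt P ψ h z| ≤ (√γ)⁻¹ * ∑ x, |featureSum P ψ x| := by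
  have h1 : PU z.1 * h z.1 ^ 2 ≤ 1 := by
    rw [← hh.2]
    exact Finset.single_le_sum (f := fun u => PU u * h u ^ 2)
      (fun u _ => mul_nonneg (hγ.trans (hPU u)).le (sq_nonneg _)) (Finset.mem_univ z.1)
  have h2 : |h z.1| ≤ (√γ)⁻¹ := by
    rw [← Real.sqrt_inv]
    refine Real.abs_le_sqrt ?_
    rw [← one_div, le_div_iff₀ hγ]
    nlinarith [hPU z.1, sq_nonneg (h z.1)]
  rw [tilt, abs_mul, abs_div, abs_of_nonneg (Real.sqrt_nonneg _)]
  have h3 : |featureSum P ψ z.2| ≤ ∑ x, |featureSum P ψ x| :=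
    Finset.single_le_sum (f := fun x => |featureSum P ψ x|) (fun _ _ => abs_nonneg _)
      (Finset.mem_univ _)
  have h4 : |h z.1| / √(eig P 1) ≤ |h z.1| :=
    div_le_self (abs_nonneg _) (Real.one_le_sqrt.2 hev)
  gcongr
  exact h4.trans h2

/-- First order expansion of the members of the exponential family. -/
theorem exists_expansion_expWeight (hψ : IsSecondEigenvector P ψ) (hP : ∀ x, 0 ≤ P x)
    (hP1 : ∑ x, P x = 1) (hpos : ∀ i a, 0 < coordMarginal P i a)
    (hPU : ∀ u, 0 ≤ PU u) (hPU1 : ∑ u, PU u = 1) {δ κ : ℝ} (hκ0 : 0 ≤ κ) (hκ : κ ≤ 1 / 12)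
    (hs : ∀ z, |√(2 * δ) * tilt P ψ h z| ≤ κ) :
    ∃ ρ : 𝒰 × (∀ i, X i) → ℝ, (∀ z, |ρ z| ≤ 6 * κ ^ 2) ∧
      (∀ z, (∑ w, expWeight P ψ PU δ h w)⁻¹ * expWeight P ψ PU δ h z =
        PU z.1 * P z.2 * (1 + (√(2 * δ) * tilt P ψ h z + ρ z))) ∧
      ∑ z, (∑ w, expWeight P ψ PU δ h w)⁻¹ * expWeight P ψ PU δ h z = 1 := by
  set y : 𝒰 × (∀ i, X i) → ℝ := fun z => √(2 * δ) * tilt P ψ h z with hy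
  have hw : ∀ z, expWeight P ψ PU δ h z = PU z.1 * P z.2 * Real.exp (y z) := fun z => by
    simp only [expWeight, hy, tilt, featureSum, mul_assoc]
  set σ : 𝒰 × (∀ i, X i) → ℝ := fun z => Real.exp (y z) - 1 - y z with hσ
  have hσ' : ∀ z, |σ z| ≤ κ ^ 2 := fun z => by
    refine (Real.abs_exp_sub_one_sub_id_le ((hs z).trans (by linarith))).trans ?_
    rw [← sq_abs]
    exact pow_le_pow_left₀ (abs_nonneg _) (hs z) 2
  set Z := ∑ w, expWeight P ψ PU δ h w with hZ
  -- The linear term has mean zero, so the normalizing constant differs from 1 only at second order.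
  have hZ1 : |Z - 1| ≤ κ ^ 2 := by
    have e : Z - 1 = ∑ z : 𝒰 × (∀ i, X i), PU z.1 * P z.2 * σ z := by
      have h0 : ∑ z : 𝒰 × (∀ i, X i), PU z.1 * P z.2 * y z = 0 := by
        rw [Fintype.sum_prod_type]
        simp only [hy, mul_assoc, ← Finset.mul_sum, mul_left_comm (P _),
          sum_mul_tilt_right hψ hpos, mul_zero, Finset.sum_const_zero]
      rw [hZ, ← sum_prod_weight hPU1 hP1, ← sub_zero (∑ z, _ - _), ← h0, ← Finset.sum_sub_distrib,
        ← Finset.sum_sub_distrib]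
      exact Finset.sum_congr rfl fun z _ => by rw [hw]; ring
    rw [e]
    exact abs_sum_mul_le (fun z => mul_nonneg (hPU _) (hP _)) (sum_prod_weight hPU1 hP1).le
      (by positivity) hσ'
  have hκ2 : κ ^ 2 ≤ 1 / 144 := by nlinarith
  have hZpos : 1 / 2 ≤ Z := by
    have := (abs_le.1 hZ1).1
    linarith
  have hZ0 : Z ≠ 0 := by linarith
  -- Solves (1 + y + σ)/Z = 1 + y + ρ for ρ.
  refine ⟨fun z => (σ z - (Z - 1) * (1 + y z)) / Z, fun z => ?_, fun z => ?_, ?_⟩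
  · rw [abs_div, abs_of_pos (by linarith : 0 < Z), div_le_iff₀ (by linarith)]
    have h1 : |σ z - (Z - 1) * (1 + y z)| ≤ κ ^ 2 + κ ^ 2 * (1 + 1 / 12) := by
      refine (abs_sub _ _).trans (add_le_add (hσ' z) ?_)
      rw [abs_mul]
      refine mul_le_mul hZ1 ((abs_add_le _ _).trans ?_) (abs_nonneg _) (sq_nonneg _)
      rw [abs_one]
      linarith [hs z]
    nlinarith [sq_nonneg κ]
  · rw [hw, hσ]
    field_simp
    ring
  · rw [← Finset.mul_sum, ← hZ, inv_mul_cancel₀ hZ0]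

end Tilt

/-! ### Feasible laws: distance from the product law, and existence. -/

section Feasible

variable {d : ℕ} {X : Fin d → Type*} [∀ i, Fintype (X i)] {P : (∀ i, X i) → ℝ} {𝒰 : Type*}
  [Fintype 𝒰] {γ : ℝ}

theorem exists_pos_le_of_pos {α : Type*} [Fintype α] (f : α → ℝ) :
    ∃ c, 0 < c ∧ ∀ x, 0 < f x → c ≤ f x := by
  classical
  by_cases h : (Finset.univ.filter fun x => 0 < f x).Nonempty
  · obtain ⟨x, hx, hmin⟩ := Finset.exists_min_image _ f h
    exact ⟨f x, (Finset.mem_filter.1 hx).2, fun y hy => hmin y (by simpa using hy)⟩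
  · refine ⟨1, one_pos, fun x hx => (h ⟨x, by simpa using hx⟩).elim⟩

/-- Feasible laws are within `O(√δ)` of the product of their marginals. -/
theorem exists_expansion_of_feasible (hP : ∀ x, 0 ≤ P x) (hP1 : ∑ x, P x = 1) (hγ : 0 < γ) :
    ∃ K : ℝ, 0 < K ∧ ∀ δ, ∀ Q ∈ feasible 𝒰 P γ δ, ∃ ε : 𝒰 × (∀ i, X i) → ℝ,
      (∀ z, Q z = marginalU Q z.1 * P z.2 * (1 + ε z)) ∧ (∀ z, |ε z| ≤ K * √δ) ∧
      (∀ u, ∑ x, P x * ε (u, x) = 0) ∧ ∀ x, ∑ u, marginalU Q u * ε (u, x) = 0 := by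
  obtain ⟨c, hc, hcP⟩ := exists_pos_le_of_pos P
  -- The Hellinger bound gives |Q - P_U P| ≤ 2√δ, and P_U P ≥ γc wherever P is positive. P itself
  -- may vanish at some tuples, so c is its least positive value.
  refine ⟨2 / (γ * c), by positivity, ?_⟩
  rintro δ Q ⟨⟨hQ0, hQ1⟩, hQX, hI, hU⟩
  have hU1 : ∑ u, marginalU Q u = 1 := (sum_marginalU Q).trans hQ1
  have hzero : ∀ z, P z.2 = 0 → Q z = 0 := fun z h =>
    eq_zero_of_marginal_mul hQ0 z (by rw [hQX, h, mul_zero])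
  have hdist := abs_sub_le_of_kl_le hQ0
    (fun z => mul_nonneg (marginalU_nonneg hQ0 z.1) (marginalX_nonneg hQ0 z.2)) hQ1
    (by rw [hQX]; exact sum_prod_weight hU1 hP1) (eq_zero_of_marginal_mul hQ0) hI
  rw [hQX] at hdist
  -- Where P vanishes, division by zero sets ε to 0. This is harmless, as Q vanishes there too.
  set ε : 𝒰 × (∀ i, X i) → ℝ := fun z =>
    (Q z - marginalU Q z.1 * P z.2) / (marginalU Q z.1 * P z.2) with hε
  have hmul : ∀ z, marginalU Q z.1 * P z.2 * ε z = Q z - marginalU Q z.1 * P z.2 := fun z => by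
    rcases (hP z.2).eq_or_lt with h | h
    · rw [hzero z h.symm, ← h]; ring
    · exact mul_div_cancel₀ _ (mul_pos (hγ.trans (hU z.1)) h).ne'
  refine ⟨ε, fun z => by rw [mul_add, hmul]; ring, fun z => ?_, fun u => ?_, fun x => ?_⟩
  · rcases (hP z.2).eq_or_lt with h | h
    · rw [hε]
      dsimp only
      rw [← h, mul_zero, div_zero, abs_zero]
      positivity
    · have hden : γ * c ≤ marginalU Q z.1 * P z.2 :=
        mul_le_mul (hU z.1).le (hcP _ h) hc.le (hγ.trans (hU z.1)).le
      rw [hε, abs_div, abs_of_pos (lt_of_lt_of_le (by positivity) hden), div_mul_eq_mul_div]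
      exact div_le_div₀ (by positivity) (hdist z) (by positivity) hden
  · have h : marginalU Q u * ∑ x, P x * ε (u, x) = 0 := by
      rw [Finset.mul_sum, Finset.sum_congr rfl fun x _ => (mul_assoc _ _ _).symm.trans
        (hmul (u, x)), Finset.sum_sub_distrib]
      dsimp only
      rw [← Finset.mul_sum, hP1, mul_one]
      exact sub_self _
    exact (mul_eq_zero.1 h).resolve_left (hγ.trans (hU u)).ne'
  · rcases (hP x).eq_or_lt with h | h
    · have : ∀ u, ε (u, x) = 0 := fun u => by
        rw [hε]; dsimp only; rw [← h, mul_zero, div_zero]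
      simp [this]
    · have h0 : P x * ∑ u, marginalU Q u * ε (u, x) = 0 := by
        rw [Finset.mul_sum]
        have : ∀ u, P x * (marginalU Q u * ε (u, x)) = Q (u, x) - marginalU Q u * P x := fun u => by
          rw [← hmul (u, x)]; ring
        rw [Finset.sum_congr rfl fun u _ => this u, Finset.sum_sub_distrib, ← Finset.sum_mul,
          hU1, one_mul]
        exact sub_eq_zero.2 (congrFun hQX x)
      exact (mul_eq_zero.1 h0).resolve_left h.ne'

/-- Witnessed by a uniform U independent of X^d. -/
theorem feasible_nonempty (hP : P ∈ stdSimplex ℝ (∀ i, X i)) [Nonempty 𝒰]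
    (hγU : γ * Fintype.card 𝒰 < 1) {δ : ℝ} (hδ : 0 < δ) : (feasible 𝒰 P γ δ).Nonempty := by
  have hcard : (0 : ℝ) < Fintype.card 𝒰 := by exact_mod_cast Fintype.card_pos
  have h1 : ∑ _u : 𝒰, (Fintype.card 𝒰 : ℝ)⁻¹ = 1 := by
    rw [Finset.sum_const, Finset.card_univ, nsmul_eq_mul, mul_inv_cancel₀ hcard.ne']
  set Q : 𝒰 × (∀ i, X i) → ℝ := fun z => (Fintype.card 𝒰 : ℝ)⁻¹ * P z.2 with hQ
  have hU : ∀ u, marginalU Q u = (Fintype.card 𝒰 : ℝ)⁻¹ := fun u => by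
    simp only [marginalU, hQ, ← Finset.mul_sum, hP.2, mul_one]
  have hX : marginalX Q = P := by
    ext x
    simp only [marginalX, hQ, ← Finset.sum_mul, h1, one_mul]
  refine ⟨Q, ⟨fun z => mul_nonneg (by positivity) (hP.1 _),
    sum_prod_weight (a := fun _ : 𝒰 => (Fintype.card 𝒰 : ℝ)⁻¹) h1 hP.2⟩, hX, ?_, fun u => ?_⟩
  · have : mutualInfo Q = 0 := Finset.sum_eq_zero fun z _ => by
      dsimp only
      rw [hU, hX]
      change Q z * Real.log (Q z / Q z) = 0
      rcases eq_or_ne (Q z) 0 with h | h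
      · rw [h, zero_mul]
      · rw [div_self h, Real.log_one, mul_zero]
    rw [this]
    exact hδ.le
  · rw [hU, ← one_div, lt_div_iff₀ hcard]
    exact hγU

end Feasible

/-! ### Near optimal feasible laws and the matching upper bound. -/

section Bounds

variable {d : ℕ} {X : Fin d → Type*} [∀ i, Fintype (X i)] [∀ i, DecidableEq (X i)]
  {P : (∀ i, X i) → ℝ} {ψ : (Σ i, X i) → ℝ} {𝒰 : Type*} [Fintype 𝒰] {γ : ℝ}

theorem prod_weight_le_one {α β : Type*} [Fintype α] [Fintype β] {a : α → ℝ} {b : β → ℝ}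
    (ha : ∀ u, 0 ≤ a u) (ha1 : ∑ u, a u = 1) (hb : ∀ x, 0 ≤ b x) (hb1 : ∑ x, b x = 1)
    (u : α) (x : β) : a u * b x ≤ 1 :=
  mul_le_one₀ (ha1 ▸ Finset.single_le_sum (fun u _ => ha u) (Finset.mem_univ u)) (hb x)
    (hb1 ▸ Finset.single_le_sum (fun x _ => hb x) (Finset.mem_univ x))

/-- The tangent law `PU P (1 + s θ)`, with `s` slightly below `√(2δ)`, is feasible and near
optimal. -/
theorem tangent_mem_feasible (hψ : IsSecondEigenvector P ψ) (hP : ∀ x, 0 ≤ P x)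
    (hP1 : ∑ x, P x = 1) (hpos : ∀ i a, 0 < coordMarginal P i a) (hev : 1 ≤ eig P 1) (hγ : 0 < γ)
    {PU h : 𝒰 → ℝ} (hPU1 : ∑ u, PU u = 1) (hPU : ∀ u, γ < PU u) (hh : h ∈ unitFunctions PU)
    {M δ : ℝ} (hM : 1 ≤ M) (hδ : 0 < δ) (hδM : 80 * M ^ 3 * √(2 * δ) ≤ 1)
    (hθ : ∀ z, |tilt P ψ h z| ≤ M) {Q : 𝒰 × (∀ i, X i) → ℝ}
    (hQ : Q = fun z => PU z.1 * P z.2 *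
      (1 + √(2 * δ) * (1 - 80 * M ^ 3 * √(2 * δ)) * tilt P ψ h z)) :
    Q ∈ feasible 𝒰 P γ δ ∧ |reduction Q - δ * (eig P 1 - 1)| ≤
      (40 * (d + 1) + 80 * (eig P 1 - 1)) * M ^ 3 * √(2 * δ) ^ 3 := by
  have hPU0 : ∀ u, 0 ≤ PU u := fun u => (hγ.trans (hPU u)).le
  have hs : 0 ≤ √(2 * δ) := Real.sqrt_nonneg _
  have hs2 : √(2 * δ) ^ 2 = 2 * δ := Real.sq_sqrt (by positivity)
  generalize √(2 * δ) = s at *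
  have hη0 : 0 ≤ 80 * M ^ 3 * s := by positivity
  have hM3 : M ≤ M ^ 3 := le_self_pow₀ hM (by norm_num)
  have hκ : s * M ≤ 1 / 80 := by nlinarith
  have ht : ∀ z, |s * (1 - 80 * M ^ 3 * s) * tilt P ψ h z| ≤ s * M := fun z => by
    rw [abs_mul, abs_of_nonneg (mul_nonneg hs (by linarith))]
    refine mul_le_mul ?_ (hθ z) (abs_nonneg _) hs
    exact mul_le_of_le_one_right hs (by linarith)
  -- As the tilt is centred in each variable, the tangent law has exactly the marginals PU and P.
  have hQU : ∀ u, marginalU Q u = PU u := fun u => by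
    simp only [marginalU, hQ, mul_add, mul_one, mul_assoc, Finset.sum_add_distrib,
      mul_left_comm (P _), ← Finset.mul_sum, hP1, sum_mul_tilt_right hψ hpos, mul_zero, add_zero]
  have hQX : marginalX Q = P := by
    ext x
    have : ∀ u, Q (u, x) = PU u * P x +
        PU u * tilt P ψ h (u, x) * (P x * (s * (1 - 80 * M ^ 3 * s))) := fun u => by
      rw [hQ]; ring
    rw [marginalX, Finset.sum_congr rfl fun u _ => this u, Finset.sum_add_distrib,
      ← Finset.sum_mul, ← Finset.sum_mul, hPU1, sum_mul_tilt_left hh]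
    ring
  have hQ1 : ∑ z, Q z = 1 := by rw [← sum_marginalX, hQX, hP1]
  obtain ⟨h1, h2⟩ := abs_sub_le_of_tilt hψ hP hP1 hpos (by linarith) hPU0 hPU1 hh (Q := Q)
    (ρ := fun _ => 0) (s := s * (1 - 80 * M ^ 3 * s)) (κ := s * M) (by positivity) (by linarith) ht
    (fun z => by rw [abs_zero]; positivity) (fun z => by rw [hQ, add_zero]) hQ1
  have hs3 : s ^ 3 = 2 * δ * s := by rw [pow_succ, hs2]
  have e1 : (s * (1 - 80 * M ^ 3 * s)) ^ 2 = 2 * δ * (1 - 80 * M ^ 3 * s) ^ 2 := by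
    rw [mul_pow, hs2]
  have e2 : 40 * (s * M) ^ 3 = δ * (80 * M ^ 3 * s) := by
    rw [mul_pow, hs3]; ring
  rw [e1, e2] at h1 h2
  have e3 : (40 * (d + 1) + 80 * (eig P 1 - 1)) * M ^ 3 * s ^ 3 =
      (d + 1) * (δ * (80 * M ^ 3 * s)) + 2 * δ * (80 * M ^ 3 * s) * (eig P 1 - 1) := by
    rw [hs3]; ring
  rw [e3]
  generalize 80 * M ^ 3 * s = η at *
  refine ⟨⟨⟨fun z => ?_, hQ1⟩, hQX, ?_, fun u => by rw [hQU]; exact hPU u⟩, ?_⟩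
  · rw [hQ]
    have := (abs_le.1 (ht z)).1
    exact mul_nonneg (mul_nonneg (hPU0 _) (hP _)) (by linarith)
  -- The shrinking η = 80M³√(2δ) is chosen so that the third-order error is δη. Then I(U;X^d) ≤ δ(1
  -- - η)² + δη ≤ δ, because η ≤ 1.
  · have := (abs_le.1 h1).2
    have h3 : η ^ 2 ≤ η := by nlinarith
    nlinarith
  · have h3 : |2 * δ * (1 - η) ^ 2 / 2 * (eig P 1 - 1) - δ * (eig P 1 - 1)| ≤
        2 * δ * η * (eig P 1 - 1) := by
      have e : 2 * δ * (1 - η) ^ 2 / 2 * (eig P 1 - 1) - δ * (eig P 1 - 1) =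
          -((2 * η - η ^ 2) * (δ * (eig P 1 - 1))) := by ring
      have h4 : 0 ≤ δ * (eig P 1 - 1) := mul_nonneg hδ.le (by linarith)
      rw [e, abs_neg, abs_of_nonneg (mul_nonneg (by nlinarith) h4)]
      nlinarith [mul_nonneg (sq_nonneg η) h4]
    exact (abs_sub_le _ _ _).trans (add_le_add h2 h3)

/-- Uniform bounds for the members of the exponential family, and a near optimal feasible law
close to each of them. -/
theorem exists_bounds_expFamily (hψ : IsSecondEigenvector P ψ) (hP : ∀ x, 0 ≤ P x)
    (hP1 : ∑ x, P x = 1) (hpos : ∀ i a, 0 < coordMarginal P i a) (hev : 1 ≤ eig P 1)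
    (hγ : 0 < γ) : ∃ C s₀ : ℝ, 0 < s₀ ∧ ∀ δ, 0 < δ → √(2 * δ) ≤ s₀ →
      ∀ PU : 𝒰 → ℝ, ∑ u, PU u = 1 → (∀ u, γ < PU u) → ∀ R ∈ expFamily P ψ PU δ,
        |mutualInfo R - δ| ≤ C * √(2 * δ) ^ 3 ∧
        (∀ x, |marginalX R x - P x| ≤ C * √(2 * δ) ^ 2) ∧
        (∀ u, |marginalU R u - PU u| ≤ C * √(2 * δ) ^ 2) ∧
        |reduction R - δ * (eig P 1 - 1)| ≤ C * √(2 * δ) ^ 3 ∧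
        ∃ Q ∈ feasible 𝒰 P γ δ, |reduction Q - δ * (eig P 1 - 1)| ≤ C * √(2 * δ) ^ 3 ∧
          ∀ z, |Q z - R z| ≤ C * √(2 * δ) ^ 2 := by
  set M : ℝ := (√γ)⁻¹ * ∑ x, |featureSum P ψ x| + 1 with hMdef
  have hM : 1 ≤ M := le_add_of_nonneg_left (by positivity)
  -- The M³ term bounds the errors of the two values, M⁴ the effect of the shrinking, and 6M² the
  -- remainder ρ.
  refine ⟨(40 * (d + 1) + 80 * (eig P 1 - 1)) * M ^ 3 + 80 * M ^ 4 + 6 * M ^ 2,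
    1 / (80 * M ^ 3), by positivity, ?_⟩
  rintro δ hδ hs₀ PU hPU1 hPU R ⟨h, hh, hR⟩
  have hPU0 : ∀ u, 0 ≤ PU u := fun u => (hγ.trans (hPU u)).le
  have hθ : ∀ z, |tilt P ψ h z| ≤ M := fun z =>
    (abs_tilt_le hγ hPU hev hh z).trans (by rw [hMdef]; linarith)
  have hs : 0 ≤ √(2 * δ) := Real.sqrt_nonneg _
  have hs2 : √(2 * δ) ^ 2 = 2 * δ := Real.sq_sqrt (by positivity)
  have hδM : 80 * M ^ 3 * √(2 * δ) ≤ 1 := by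
    rw [le_div_iff₀ (by positivity)] at hs₀
    linarith
  have hM3 : M ≤ M ^ 3 := le_self_pow₀ hM (by norm_num)
  have hκ : √(2 * δ) * M ≤ 1 / 80 := by nlinarith
  have ht : ∀ z, |√(2 * δ) * tilt P ψ h z| ≤ √(2 * δ) * M := fun z => by
    rw [abs_mul, abs_of_nonneg hs]
    exact mul_le_mul_of_nonneg_left (hθ z) hs
  obtain ⟨ρ, hρ, hRρ, hR1⟩ := exists_expansion_expWeight hψ hP hP1 hpos hPU0 hPU1
    (by positivity) (by linarith : √(2 * δ) * M ≤ 1 / 12) ht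
  replace hRρ : ∀ z, R z = _ := fun z => (congrFun hR z).trans (hRρ z)
  replace hR1 : ∑ z, R z = 1 := by rw [hR]; exact hR1
  obtain ⟨h1, h2⟩ := abs_sub_le_of_tilt hψ hP hP1 hpos (by linarith) hPU0 hPU1 hh
    (by positivity) (by linarith) ht hρ hRρ hR1
  obtain ⟨hQ, hQr⟩ := tangent_mem_feasible hψ hP hP1 hpos hev hγ hPU1 hPU hh hM hδ hδM hθ rfl
  have hev' : 0 ≤ eig P 1 - 1 := by linarith
  have hA : 0 ≤ 40 * d * M ^ 3 := by positivity
  have hB : 0 ≤ 80 * (eig P 1 - 1) * M ^ 3 := by positivity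
  have hC : 0 ≤ M ^ 4 := by positivity
  have hD : 0 ≤ M ^ 2 := by positivity
  have hE : 0 ≤ M ^ 3 := by positivity
  have hs3 : 0 ≤ √(2 * δ) ^ 3 := by positivity
  have hs2' : 0 ≤ √(2 * δ) ^ 2 := by positivity
  have hρ' : ∀ z, |ρ z| ≤ 6 * M ^ 2 * √(2 * δ) ^ 2 := fun z => (hρ z).trans_eq (by ring)
  have hρC : 6 * M ^ 2 * √(2 * δ) ^ 2 ≤
      ((40 * (d + 1) + 80 * (eig P 1 - 1)) * M ^ 3 + 80 * M ^ 4 + 6 * M ^ 2) * √(2 * δ) ^ 2 :=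
    mul_le_mul_of_nonneg_right (by linarith) hs2'
  rw [hs2, mul_div_cancel_left₀ _ two_ne_zero] at h1 h2
  refine ⟨h1.trans ?_, fun x => ?_, fun u => ?_, h2.trans ?_, _, hQ, hQr.trans ?_, fun z => ?_⟩
  · rw [mul_pow, mul_comm (√(2 * δ) ^ 3), ← mul_assoc]
    exact mul_le_mul_of_nonneg_right (by linarith) hs3
  · have e : marginalX R x - P x = P x * ∑ u, PU u * ρ (u, x) := by
      have : ∀ u, R (u, x) = PU u * P x + PU u * tilt P ψ h (u, x) * (P x * √(2 * δ)) +
          P x * (PU u * ρ (u, x)) := fun u => by rw [hRρ]; ring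
      rw [marginalX, Finset.sum_congr rfl fun u _ => this u, Finset.sum_add_distrib,
        Finset.sum_add_distrib, ← Finset.sum_mul, ← Finset.sum_mul, hPU1, sum_mul_tilt_left hh,
        ← Finset.mul_sum]
      ring
    rw [e, abs_mul, abs_of_nonneg (hP x)]
    have hPx : P x ≤ 1 := hP1 ▸ Finset.single_le_sum (fun x _ => hP x) (Finset.mem_univ x)
    exact (mul_le_of_le_one_left (abs_nonneg _) hPx).trans
      ((abs_sum_mul_le hPU0 hPU1.le (by positivity) fun u => hρ' (u, x)).trans hρC)
  · have e : marginalU R u - PU u = PU u * ∑ x, P x * ρ (u, x) := by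
      have : ∀ x, R (u, x) = P x * PU u + P x * tilt P ψ h (u, x) * (PU u * √(2 * δ)) +
          PU u * (P x * ρ (u, x)) := fun x => by rw [hRρ]; ring
      rw [marginalU, Finset.sum_congr rfl fun x _ => this x, Finset.sum_add_distrib,
        Finset.sum_add_distrib, ← Finset.sum_mul, ← Finset.sum_mul, hP1,
        sum_mul_tilt_right hψ hpos, ← Finset.mul_sum]
      ring
    rw [e, abs_mul, abs_of_nonneg (hPU0 u)]
    have hPx : PU u ≤ 1 := hPU1 ▸ Finset.single_le_sum (fun u _ => hPU0 u) (Finset.mem_univ u)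
    exact (mul_le_of_le_one_left (abs_nonneg _) hPx).trans
      ((abs_sum_mul_le hP hP1.le (by positivity) fun x => hρ' (u, x)).trans hρC)
  · rw [mul_pow, mul_comm (√(2 * δ) ^ 3), ← mul_assoc, ← mul_assoc]
    exact mul_le_mul_of_nonneg_right (by linarith) hs3
  · exact mul_le_mul_of_nonneg_right (by linarith) hs3
  · have e : PU z.1 * P z.2 * (1 + √(2 * δ) * (1 - 80 * M ^ 3 * √(2 * δ)) * tilt P ψ h z) - R z =
        PU z.1 * P z.2 * -(80 * M ^ 3 * √(2 * δ) ^ 2 * tilt P ψ h z + ρ z) := by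
      rw [hRρ]; ring
    rw [e, abs_mul, abs_of_nonneg (mul_nonneg (hPU0 _) (hP _)), abs_neg]
    refine (mul_le_of_le_one_left (abs_nonneg _)
      (prod_weight_le_one hPU0 hPU1 hP hP1 _ _)).trans ((abs_add_le _ _).trans ?_)
    have h5 : |80 * M ^ 3 * √(2 * δ) ^ 2 * tilt P ψ h z| ≤ 80 * M ^ 4 * √(2 * δ) ^ 2 := by
      rw [abs_mul, abs_of_nonneg (by positivity)]
      exact (mul_le_mul_of_nonneg_left (hθ z) (by positivity)).trans_eq (by ring)
    refine (add_le_add h5 (hρ' z)).trans ?_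
    rw [← add_mul]
    exact mul_le_mul_of_nonneg_right (by linarith) hs2'

/-- Second order expansions at feasible laws. -/
theorem abs_sub_le_of_feasible (hP : ∀ x, 0 ≤ P x) (hP1 : ∑ x, P x = 1)
    (hpos : ∀ i a, 0 < coordMarginal P i a) {δ η : ℝ}
    {Q ε : 𝒰 × (∀ i, X i) → ℝ} (hQ : Q ∈ feasible 𝒰 P γ δ)
    (hQε : ∀ z, Q z = marginalU Q z.1 * P z.2 * (1 + ε z)) (hη : η ≤ 1 / 2)
    (hε : ∀ z, |ε z| ≤ η) (hU : ∀ u, ∑ x, P x * ε (u, x) = 0)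
    (hX : ∀ x, ∑ u, marginalU Q u * ε (u, x) = 0) :
    |mutualInfo Q - (∑ z : 𝒰 × (∀ i, X i), marginalU Q z.1 * P z.2 * ε z ^ 2) / 2| ≤
      4 * η ^ 3 ∧
    |reduction Q - (∑ u, marginalU Q u * energy P (fun x => ε (u, x)) -
      ∑ z : 𝒰 × (∀ i, X i), marginalU Q z.1 * P z.2 * ε z ^ 2) / 2| ≤ (d + 1) * (4 * η ^ 3) := by
  obtain ⟨⟨hQ0, hQ1⟩, -⟩ := hQ
  have hU0 : ∀ u, 0 ≤ marginalU Q u := marginalU_nonneg hQ0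
  have hU1 : ∑ u, marginalU Q u = 1 := (sum_marginalU Q).trans hQ1
  have h1 := abs_mutualInfo_sub_le (τ := 0) hU0 hP hU1 hP1 hQε hQ1 hη hε (by norm_num)
    (fun u => by rw [hU, abs_zero]) fun x => by rw [hX, abs_zero]
  have h2 := abs_reduction_sub_le (τ := 0) hU0 hP hpos hU1 hP1 hQε hQ1 hη hε (by norm_num)
    (fun u => by rw [hU, abs_zero]) fun x => by rw [hX, abs_zero]
  norm_num only [add_zero, mul_zero] at h1 h2
  exact ⟨h1, h2⟩

/-- Conditional total correlations are nonnegative. This is what makes the supremum finite. -/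
theorem reduction_le_totalCorrelation (hγ : 0 < γ) {δ : ℝ} {Q : 𝒰 × (∀ i, X i) → ℝ}
    (hQ : Q ∈ feasible 𝒰 P γ δ) : reduction Q ≤ totalCorrelation P := by
  obtain ⟨⟨hQ0, hQ1⟩, hQX, hI, hU⟩ := hQ
  rw [reduction, hQX, sub_le_self_iff]
  refine Finset.sum_nonneg fun u _ => ?_
  have hu := hγ.trans (hU u)
  have hc0 : ∀ x, 0 ≤ condX Q u x := fun x => div_nonneg (hQ0 _) hu.le
  have hc1 : ∑ x, condX Q u x = 1 := by
    simp only [condX, ← Finset.sum_div]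
    exact div_self hu.ne'
  refine mul_nonneg hu.le (kl_nonneg hc0
    (fun x => Finset.prod_nonneg fun i _ => coordMarginal_nonneg hc0 i _) ?_ fun x hx => ?_)
  · rw [hc1, ← Fintype.prod_sum]
    exact (Finset.prod_eq_one fun i _ => (sum_coordMarginal _ i).trans hc1).symm
  · obtain ⟨i, -, hi⟩ := Finset.prod_eq_zero_iff.1 hx
    exact le_antisymm (hi ▸ le_coordMarginal hc0 i x) (hc0 x)

/-- Uniform upper bound for the reduction at feasible laws. -/
theorem exists_reduction_le (hP : ∀ x, 0 ≤ P x) (hP1 : ∑ x, P x = 1)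
    (hpos : ∀ i a, 0 < coordMarginal P i a) (hX : ∃ i, Nontrivial (X i)) (hγ : 0 < γ) :
    ∃ C s₀ : ℝ, 0 < s₀ ∧ ∀ δ, √δ ≤ s₀ → ∀ Q ∈ feasible 𝒰 P γ δ,
      reduction Q ≤ δ * (eig P 1 - 1) + C * √δ ^ 3 := by
  obtain ⟨K, hK, hexp⟩ := exists_expansion_of_feasible (𝒰 := 𝒰) hP hP1 hγ
  refine ⟨4 * (eig P 1 + d) * K ^ 3, 1 / (2 * K), by positivity, fun δ hδ Q hQ => ?_⟩
  obtain ⟨ε, hQε, hε, hU0, hX0⟩ := hexp δ Q hQ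
  have hη : K * √δ ≤ 1 / 2 := by
    rw [le_div_iff₀ (by positivity)] at hδ
    linarith
  obtain ⟨h1, h2⟩ := abs_sub_le_of_feasible hP hP1 hpos hQ hQε hη hε hU0 hX0
  have hen : ∑ u, marginalU Q u * energy P (fun x => ε (u, x)) ≤
      eig P 1 * ∑ z : 𝒰 × (∀ i, X i), marginalU Q z.1 * P z.2 * ε z ^ 2 := by
    simp only [Fintype.sum_prod_type, Finset.mul_sum]
    refine Finset.sum_le_sum fun u _ => ?_
    refine (mul_le_mul_of_nonneg_left (energy_le_eig_one hP hP1 hpos hX (hU0 u))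
      (marginalU_nonneg hQ.1.1 u)).trans_eq ?_
    simp only [Finset.mul_sum]
    exact Finset.sum_congr rfl fun x _ => by ring
  have hev := one_le_eig_one hP hP1 hpos hX
  have hI := hQ.2.2.1
  have h3 := (abs_le.1 h1).1
  have h4 := (abs_le.1 h2).2
  have e : 4 * (eig P 1 + d) * K ^ 3 * √δ ^ 3 =
      (eig P 1 - 1) * (4 * (K * √δ) ^ 3) + (d + 1) * (4 * (K * √δ) ^ 3) := by ring
  rw [e]
  generalize ∑ z : 𝒰 × (∀ i, X i), marginalU Q z.1 * P z.2 * ε z ^ 2 = S at *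
  -- The reduction is at most (λ^{(1)} - 1)S/2 up to error, and the information constraint bounds
  -- S/2 by δ up to error. Combining the two needs λ^{(1)} ≥ 1.
  have h5 : (eig P 1 - 1) * (S / 2) ≤ (eig P 1 - 1) * (δ + 4 * (K * √δ) ^ 3) :=
    mul_le_mul_of_nonneg_left (by linarith) (by linarith)
  nlinarith

end Bounds

/-! ### Near optimal laws are close to the exponential family. -/

section Stability

variable {d : ℕ} {X : Fin d → Type*} [∀ i, Fintype (X i)] [∀ i, DecidableEq (X i)]
  {P : (∀ i, X i) → ℝ} {ψ : (Σ i, X i) → ℝ} {𝒰 : Type*} [Fintype 𝒰] {γ : ℝ}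

theorem abs_sqrt_sub_sqrt_le {a b : ℝ} (ha : 0 ≤ a) (hb : 0 ≤ b) : |√a - √b| ≤ √|a - b| := by
  refine Real.abs_le_sqrt ?_
  have e : a - b = (√a - √b) * (√a + √b) := by
    linear_combination -(Real.sq_sqrt ha) + (Real.sq_sqrt hb)
  rw [e, abs_mul, ← sq_abs, sq]
  refine mul_le_mul_of_nonneg_left ?_ (abs_nonneg _)
  rw [abs_of_nonneg (add_nonneg (Real.sqrt_nonneg a) (Real.sqrt_nonneg b))]
  refine (abs_sub _ _).trans_eq ?_
  rw [abs_of_nonneg (Real.sqrt_nonneg a), abs_of_nonneg (Real.sqrt_nonneg b)]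

/-- The component along the feature sum of `ψ` carries almost all of the second moment of a near
optimal perturbation. -/
theorem exists_decomposition_of_feasible (hψ : IsSecondEigenvector P ψ) (hP : ∀ x, 0 ≤ P x)
    (hP1 : ∑ x, P x = 1) (hpos : ∀ i a, 0 < coordMarginal P i a) (hX : ∃ i, Nontrivial (X i))
    (hγ : 0 < γ) (h1 : 1 < eig P 1) (h2 : eig P 2 < eig P 1) :
    ∃ D s₀ : ℝ, 0 < D ∧ 0 < s₀ ∧ ∀ δ, 0 < δ → √δ ≤ s₀ → ∀ Q ∈ feasible 𝒰 P γ δ,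
      ∃ (c : 𝒰 → ℝ) (r : 𝒰 × (∀ i, X i) → ℝ),
        (∀ z, Q z = marginalU Q z.1 * P z.2 * (1 + (c z.1 * featureSum P ψ z.2 + r z))) ∧
        ∑ u, marginalU Q u * c u = 0 ∧
        |eig P 1 * ∑ u, marginalU Q u * c u ^ 2 - 2 * δ| ≤
          D * (√δ ^ 3 + |reduction Q - δ * (eig P 1 - 1)|) ∧
        ∑ z : 𝒰 × (∀ i, X i), marginalU Q z.1 * P z.2 * r z ^ 2 ≤
          D * (√δ ^ 3 + |reduction Q - δ * (eig P 1 - 1)|) := by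
  obtain ⟨K, hK, hexp⟩ := exists_expansion_of_feasible (𝒰 := 𝒰) hP hP1 hγ
  set κ := max (eig P 2) 0 with hκ
  have hκ1 : κ < eig P 1 := max_lt h2 (zero_lt_one.trans h1)
  set Λ := eig P 1 with hΛ
  have hΛ0 : 0 < Λ := zero_lt_one.trans h1
  set E₀ := 8 * (Λ + d) * K ^ 3 + 2 with hE₀
  have hE₀0 : 0 < E₀ := by positivity
  have hg : 0 < Λ - κ := by linarith
  have hg1 : 0 < Λ - 1 := by linarith
  refine ⟨E₀ / (Λ - κ) + E₀ / (Λ - 1) + 8 * K ^ 3, 1 / (2 * K), by positivity, by positivity,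
    fun δ hδ hδs Q hQ => ?_⟩
  obtain ⟨ε, hQε, hε, hU0, hX0⟩ := hexp δ Q hQ
  have hη : K * √δ ≤ 1 / 2 := by
    rw [le_div_iff₀ (by positivity)] at hδs
    linarith
  obtain ⟨hmi, hred⟩ := abs_sub_le_of_feasible hP hP1 hpos hQ hQε hη hε hU0 hX0
  set F := featureSum P ψ with hF
  -- The regression coefficient of ε(u, ·) on F in L²(P), where E[F²] = Λ; the residual r is
  -- orthogonal to F.
  set c : 𝒰 → ℝ := fun u => (∑ x, P x * (F x * ε (u, x))) / Λ with hc
  set r : 𝒰 × (∀ i, X i) → ℝ := fun z => ε z - c z.1 * F z.2 with hr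
  have hFsq : ∑ x, P x * (F x * F x) = Λ := by
    refine Eq.trans (Finset.sum_congr rfl fun x _ => ?_) (hψ.sum_featureSum_sq hpos)
    rw [sq]
  have hr0 : ∀ u, ∑ x, P x * r (u, x) = 0 := fun u => by
    simp only [hr, mul_sub, Finset.sum_sub_distrib, mul_left_comm (P _), ← Finset.mul_sum]
    rw [hU0, hψ.sum_featureSum_eq_zero hpos, mul_zero, sub_zero]
  have hrF : ∀ u, ∑ x, P x * (F x * r (u, x)) = 0 := fun u => by
    have : ∀ x, P x * (F x * r (u, x)) = P x * (F x * ε (u, x)) - c u * (P x * (F x * F x)) :=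
      fun x => by simp only [hr]; ring
    rw [Finset.sum_congr rfl fun x _ => this x, Finset.sum_sub_distrib, ← Finset.mul_sum, hFsq, hc,
      div_mul_cancel₀ _ hΛ0.ne', sub_self]
  have hεr : ∀ u, (fun x => ε (u, x)) = fun x => c u * F x + r (u, x) := fun u => by
    ext x; simp only [hr]; ring
  have hsq : ∀ u, ∑ x, P x * ε (u, x) ^ 2 = Λ * c u ^ 2 + ∑ x, P x * r (u, x) ^ 2 := fun u => by
    have : ∀ x, P x * ε (u, x) ^ 2 = c u ^ 2 * (P x * (F x * F x)) +
        2 * c u * (P x * (F x * r (u, x))) + P x * r (u, x) ^ 2 := fun x => by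
      rw [congrFun (hεr u) x]; ring
    rw [Finset.sum_congr rfl fun x _ => this x, Finset.sum_add_distrib, Finset.sum_add_distrib,
      ← Finset.mul_sum, ← Finset.mul_sum, hFsq, hrF]
    ring
  have hU := fun u => marginalU_nonneg hQ.1.1 u
  set W := Λ * ∑ u, marginalU Q u * c u ^ 2 with hW
  set T := ∑ z : 𝒰 × (∀ i, X i), marginalU Q z.1 * P z.2 * r z ^ 2 with hT
  have hT0 : 0 ≤ T := Finset.sum_nonneg fun z _ =>
    mul_nonneg (mul_nonneg (hU _) (hP _)) (sq_nonneg _)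
  have hTu : T = ∑ u, marginalU Q u * ∑ x, P x * r (u, x) ^ 2 := by
    rw [hT, Fintype.sum_prod_type]
    simp only [Finset.mul_sum, mul_assoc]
  have hWT : ∑ z : 𝒰 × (∀ i, X i), marginalU Q z.1 * P z.2 * ε z ^ 2 = W + T := by
    rw [Fintype.sum_prod_type, hTu, hW, Finset.mul_sum, ← Finset.sum_add_distrib]
    refine Finset.sum_congr rfl fun u _ => ?_
    simp only [mul_assoc, ← Finset.mul_sum]
    rw [hsq]
    ring
  have hen : ∑ u, marginalU Q u * energy P (fun x => ε (u, x)) ≤ Λ * W + κ * T := by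
    rw [hTu, hW, Finset.mul_sum, Finset.mul_sum, Finset.mul_sum, ← Finset.sum_add_distrib]
    refine Finset.sum_le_sum fun u _ => ?_
    rw [hεr, hψ.energy_add hP hpos _ (hrF u)]
    have h3 := hψ.energy_le hP hP1 hpos hX (le_max_left _ 0) hκ1 (hr0 u) (hrF u)
    rw [max_eq_left (le_max_right _ _)] at h3
    refine (mul_le_mul_of_nonneg_left (add_le_add_right h3 _) (hU u)).trans_eq ?_
    ring
  rw [hWT] at hmi hred
  have hI := hQ.2.2.1
  have h3 := (abs_le.1 hmi).1
  have h4 := (abs_le.1 hred).2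
  have h5 := (abs_le.1 (le_refl |reduction Q - δ * (Λ - 1)|)).1
  set e := |reduction Q - δ * (Λ - 1)| with he
  have he0 : 0 ≤ e := abs_nonneg _
  have hq0 : 0 ≤ √δ ^ 3 := by positivity
  have e3 : (K * √δ) ^ 3 = K ^ 3 * √δ ^ 3 := mul_pow _ _ _
  rw [e3] at h3 h4
  have hE : 8 * (Λ + d) * (K ^ 3 * √δ ^ 3) + 2 * e ≤ E₀ * (√δ ^ 3 + e) := by
    have : E₀ * (√δ ^ 3 + e) = 8 * (Λ + d) * (K ^ 3 * √δ ^ 3) + 2 * e +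
      (2 * √δ ^ 3 + 8 * (Λ + d) * K ^ 3 * e) := by rw [hE₀]; ring
    rw [this]
    exact le_add_of_nonneg_right (by positivity)
  have hY0 : 0 ≤ √δ ^ 3 + e := add_nonneg hq0 he0
  have h6 : (Λ - 1) * (W + T) ≤ (Λ - 1) * (2 * δ + 8 * (K ^ 3 * √δ ^ 3)) :=
    mul_le_mul_of_nonneg_left (by linarith) hg1.le
  -- Near optimality, with the energy bounded by ΛW + κT = Λ(W + T) - (Λ - κ)T. Against `h6` this
  -- bounds T through the gap Λ - κ. Dropping T instead and dividing by Λ - 1 > 0 bounds W + T from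
  -- below.
  have h7 : 2 * δ * (Λ - 1) ≤ (Λ - 1) * (W + T) - (Λ - κ) * T + 2 * e +
      8 * (d + 1) * (K ^ 3 * √δ ^ 3) := by linarith
  have hTle : T ≤ E₀ / (Λ - κ) * (√δ ^ 3 + e) := by
    rw [div_mul_eq_mul_div, le_div_iff₀ hg]
    linarith
  have hK3 : 0 ≤ K ^ 3 * √δ ^ 3 := by positivity
  have hWTge : 2 * δ - E₀ / (Λ - 1) * (√δ ^ 3 + e) ≤ W + T := by
    have h8 : 2 * δ * (Λ - 1) ≤ (Λ - 1) * (W + T) + E₀ * (√δ ^ 3 + e) := by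
      have := mul_nonneg hg.le hT0
      have := mul_nonneg hg1.le hK3
      linarith
    rw [div_mul_eq_mul_div, sub_le_iff_le_add, ← mul_le_mul_iff_of_pos_right hg1, add_mul,
      div_mul_cancel₀ _ hg1.ne']
    linarith
  have hp1 : 0 ≤ E₀ / (Λ - κ) * (√δ ^ 3 + e) := by positivity
  have hp2 : 0 ≤ E₀ / (Λ - 1) * (√δ ^ 3 + e) := by positivity
  have hp3 : 0 ≤ K ^ 3 * e := by positivity
  refine ⟨c, r, fun z => ?_, ?_, ?_, ?_⟩
  · rw [hQε]
    simp only [hr]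
    ring
  · have : ∀ u, marginalU Q u * c u = (∑ x, marginalU Q u * ε (u, x) * (P x * F x)) / Λ :=
      fun u => by
        rw [hc, mul_div_assoc', Finset.mul_sum]
        congr 1
        exact Finset.sum_congr rfl fun x _ => by ring
    rw [Finset.sum_congr rfl fun u _ => this u, ← Finset.sum_div, Finset.sum_comm]
    simp only [← Finset.sum_mul, hX0, zero_mul, Finset.sum_const_zero, zero_div]
  · rw [abs_le]
    constructor <;> linarith
  · linarith

/-- Near optimal feasible laws are close to the exponential family. -/
theorem exists_expFamily_near (hψ : IsSecondEigenvector P ψ) (hP : ∀ x, 0 ≤ P x)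
    (hP1 : ∑ x, P x = 1) (hpos : ∀ i a, 0 < coordMarginal P i a) (hX : ∃ i, Nontrivial (X i))
    (hγ : 0 < γ) (h1 : 1 < eig P 1) (h2 : eig P 2 < eig P 1) :
    ∃ D C s₀ : ℝ, 0 < s₀ ∧ ∀ δ, 0 < δ → √δ ≤ s₀ → ∀ Q ∈ feasible 𝒰 P γ δ, ∀ A,
      A = D * (√δ ^ 3 + |reduction Q - δ * (eig P 1 - 1)|) → A ≤ δ →
      ∃ R ∈ expFamily P ψ (marginalU Q) δ, ∀ z, |Q z - R z| ≤ C * (√A + δ) := by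
  obtain ⟨D, s₁, hD, hs₁, hdec⟩ :=
    exists_decomposition_of_feasible (𝒰 := 𝒰) hψ hP hP1 hpos hX hγ h1 h2
  set M : ℝ := (√γ)⁻¹ * ∑ x, |featureSum P ψ x| + 1 with hMdef
  have hM : 1 ≤ M := le_add_of_nonneg_left (by positivity)
  refine ⟨D, 12 * M ^ 2 + 1, min s₁ (1 / (24 * M)), lt_min hs₁ (by positivity),
    fun δ hδ hδs Q hQ A hA hAδ => ?_⟩
  obtain ⟨c, r, hQr, hc0, hcW, hrT⟩ := hdec δ hδ (hδs.trans (min_le_left _ _)) Q hQ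
  rw [← hA] at hcW hrT
  have hA0 : 0 ≤ A := (abs_nonneg _).trans hcW
  have hΛ0 : 0 < eig P 1 := zero_lt_one.trans h1
  have hU := hQ.2.2.2
  have hU0 := fun u => (hγ.trans (hU u)).le
  have hU1 : ∑ u, marginalU Q u = 1 := (sum_marginalU Q).trans hQ.1.2
  set W := eig P 1 * ∑ u, marginalU Q u * c u ^ 2 with hW
  -- W is within A ≤ δ of 2δ, so it is positive and c can be normalized.
  have hWpos : 0 < W := by
    have := (abs_le.1 hcW).1
    linarith
  have hWsq := Real.sq_sqrt hWpos.le
  have hΛsq := Real.sq_sqrt hΛ0.le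
  have hWs := Real.sqrt_pos.2 hWpos
  have hΛs := Real.sqrt_pos.2 hΛ0
  -- Scaled to unit variance, so that c F = √W · tilt, to be compared with √(2δ) · tilt in the
  -- exponential family.
  set h : 𝒰 → ℝ := fun u => c u * (√(eig P 1) / √W) with hh
  have hhU : h ∈ unitFunctions (marginalU Q) := by
    constructor
    · simp only [hh, ← mul_assoc, ← Finset.sum_mul, hc0, zero_mul]
    · simp only [hh, mul_pow, div_pow, hWsq, hΛsq, ← mul_assoc, ← Finset.sum_mul]
      rw [mul_div_assoc', mul_comm, ← hW, div_self hWpos.ne']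
  have hθ : ∀ z, |tilt P ψ h z| ≤ M := fun z =>
    (abs_tilt_le hγ hU h1.le hhU z).trans (by rw [hMdef]; linarith)
  have hθc : ∀ z, c z.1 * featureSum P ψ z.2 = √W * tilt P ψ h z := fun z => by
    simp only [tilt, hh]
    field_simp
  have hs : 0 ≤ √(2 * δ) := Real.sqrt_nonneg _
  have hs2 : √(2 * δ) ^ 2 = 2 * δ := Real.sq_sqrt (by positivity)
  have hs2' : √(2 * δ) ≤ 2 * √δ := by
    rw [Real.sqrt_mul zero_le_two]
    refine mul_le_mul_of_nonneg_right ?_ (Real.sqrt_nonneg _)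
    rw [Real.sqrt_le_left zero_le_two]
    norm_num
  have hκ : √(2 * δ) * M ≤ 1 / 12 := by
    have := hδs.trans (min_le_right _ _)
    rw [le_div_iff₀ (by positivity)] at this
    nlinarith
  obtain ⟨ρ, hρ, hRρ, hR1⟩ := exists_expansion_expWeight (h := h) hψ hP hP1 hpos hU0 hU1
    (by positivity) hκ fun z => by
      rw [abs_mul, abs_of_nonneg hs]
      exact mul_le_mul_of_nonneg_left (hθ z) hs
  refine ⟨_, ⟨h, hhU, rfl⟩, fun z => ?_⟩
  have hw0 : 0 ≤ marginalU Q z.1 * P z.2 := mul_nonneg (hU0 _) (hP _)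
  have hw1 := prod_weight_le_one hU0 hU1 hP hP1 z.1 z.2
  -- Each weight w is at most 1, so (w r)² ≤ w r², a single term of a sum bounded by A.
  have hr : |marginalU Q z.1 * P z.2 * r z| ≤ √A := by
    refine Real.abs_le_sqrt (le_trans ?_ hrT)
    refine le_trans ?_ (Finset.single_le_sum
      (f := fun z : 𝒰 × (∀ i, X i) => marginalU Q z.1 * P z.2 * r z ^ 2)
      (fun z _ => mul_nonneg (mul_nonneg (hU0 _) (hP _)) (sq_nonneg _)) (Finset.mem_univ z))
    rw [mul_pow]
    refine mul_le_mul_of_nonneg_right ?_ (sq_nonneg _)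
    rw [sq]
    exact mul_le_of_le_one_left hw0 hw1
  have hWδ : |√W - √(2 * δ)| ≤ √A :=
    (abs_sqrt_sub_sqrt_le hWpos.le (by positivity)).trans (Real.sqrt_le_sqrt hcW)
  have hρ' : |ρ z| ≤ 12 * M ^ 2 * δ := (hρ z).trans_eq (by rw [mul_pow, hs2]; ring)
  have e : Q z - (∑ w, expWeight P ψ (marginalU Q) δ h w)⁻¹ * expWeight P ψ (marginalU Q) δ h z =
      marginalU Q z.1 * P z.2 * ((√W - √(2 * δ)) * tilt P ψ h z - ρ z) +
        marginalU Q z.1 * P z.2 * r z := by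
    rw [hRρ, hQr, hθc]; ring
  rw [e]
  have h3 : |(√W - √(2 * δ)) * tilt P ψ h z - ρ z| ≤ √A * M + 12 * M ^ 2 * δ := by
    refine (abs_sub _ _).trans (add_le_add ?_ hρ')
    rw [abs_mul]
    exact mul_le_mul hWδ (hθ z) (abs_nonneg _) (Real.sqrt_nonneg _)
  refine (abs_add_le _ _).trans ((add_le_add ?_ hr).trans
    (?_ : √A * M + 12 * M ^ 2 * δ + √A ≤ _))
  · rw [abs_mul, abs_of_nonneg hw0]
    exact (mul_le_of_le_one_left (abs_nonneg _) hw1).trans h3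
  · have hM2 : 0 ≤ 12 * M ^ 2 - M := by nlinarith
    have := mul_nonneg (Real.sqrt_nonneg A) hM2
    linarith

end Stability

/-! ### Translation of uniform bounds into Landau symbols. -/

section Asymptotic

theorem isLittleO_sqrt_pow_three : (fun δ : ℝ => √δ ^ 3) =o[𝓝[>] 0] fun δ => δ := by
  have h : (fun δ : ℝ => √δ * δ) =o[𝓝[>] 0] fun δ => (1 : ℝ) * δ := by
    refine IsLittleO.mul_isBigO ?_ (isBigO_refl _ _)
    rw [isLittleO_one_iff]
    have := (Real.continuous_sqrt.tendsto 0).mono_left (nhdsWithin_le_nhds (s := Set.Ioi 0))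
    rwa [Real.sqrt_zero] at this
  refine (h.congr' ?_ ?_)
  · filter_upwards [self_mem_nhdsWithin] with δ hδ
    rw [pow_succ, Real.sq_sqrt (le_of_lt hδ), mul_comm]
  · exact Eventually.of_forall fun δ => one_mul δ

theorem isLittleO_id_sqrt : (fun δ : ℝ => δ) =o[𝓝[>] 0] fun δ => √δ := by
  have h : (fun δ : ℝ => √δ * √δ) =o[𝓝[>] 0] fun δ => (1 : ℝ) * √δ := by
    refine IsLittleO.mul_isBigO ?_ (isBigO_refl _ _)
    rw [isLittleO_one_iff]
    have := (Real.continuous_sqrt.tendsto 0).mono_left (nhdsWithin_le_nhds (s := Set.Ioi 0))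
    rwa [Real.sqrt_zero] at this
  refine h.congr' ?_ ?_
  · filter_upwards [self_mem_nhdsWithin] with δ hδ
    exact Real.mul_self_sqrt (le_of_lt hδ)
  · exact Eventually.of_forall fun δ => one_mul _

theorem sqrt_two_mul_sq_isBigO (C : ℝ) :
    (fun δ : ℝ => C * √(2 * δ) ^ 2) =O[𝓝[>] 0] fun δ => δ := by
  refine IsBigO.const_mul_left (IsBigO.of_bound 2 ?_) C
  filter_upwards [self_mem_nhdsWithin] with δ hδ
  have hδ' : 0 < δ := hδ
  rw [Real.sq_sqrt (by positivity), norm_mul, Real.norm_two]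

theorem sqrt_two_mul_pow_three_isLittleO (C : ℝ) :
    (fun δ : ℝ => C * √(2 * δ) ^ 3) =o[𝓝[>] 0] fun δ => δ := by
  have h := isLittleO_sqrt_pow_three.const_mul_left (C * √2 ^ 3)
  refine h.congr_left fun δ => ?_
  rw [Real.sqrt_mul zero_le_two]
  ring

theorem isLittleO_of_abs_le {f g k : ℝ → ℝ} (hg : g =o[𝓝[>] 0] k)
    (h : ∀ᶠ δ in 𝓝[>] 0, |f δ| ≤ g δ) : f =o[𝓝[>] 0] k :=
  (IsBigO.of_bound 1 (h.mono fun δ hδ => by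
    rw [one_mul]; exact hδ.trans (le_abs_self _))).trans_isLittleO hg

theorem isBigO_of_abs_le {f g k : ℝ → ℝ} (hg : g =O[𝓝[>] 0] k)
    (h : ∀ᶠ δ in 𝓝[>] 0, |f δ| ≤ g δ) : f =O[𝓝[>] 0] k :=
  (IsBigO.of_bound 1 (h.mono fun δ hδ => by
    rw [one_mul]; exact hδ.trans (le_abs_self _))).trans hg

theorem isLittleO_sqrt_of_isLittleO {A : ℝ → ℝ} (hA : A =o[𝓝[>] 0] fun δ => δ) :
    (fun δ => √(A δ)) =o[𝓝[>] 0] fun δ => √δ := by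
  rw [isLittleO_iff] at hA ⊢
  intro ε hε
  filter_upwards [hA (pow_pos hε 2), self_mem_nhdsWithin] with δ h hδ
  have hδ' : 0 < δ := hδ
  rw [Real.norm_of_nonneg (Real.sqrt_nonneg _), Real.norm_of_nonneg (Real.sqrt_nonneg _)]
  rw [Real.norm_of_nonneg hδ'.le] at h
  calc √(A δ) ≤ √(ε ^ 2 * δ) := Real.sqrt_le_sqrt ((le_abs_self _).trans h)
    _ = ε * √δ := by rw [Real.sqrt_mul (by positivity), Real.sqrt_sq hε.le]

theorem eventually_sqrt_mul_le (c : ℝ) {s₀ : ℝ} (hs₀ : 0 < s₀) :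
    ∀ᶠ δ in 𝓝[>] (0 : ℝ), √(c * δ) ≤ s₀ := by
  have h : Tendsto (fun δ : ℝ => √(c * δ)) (𝓝[>] 0) (𝓝 0) := by
    have hc : Continuous fun δ : ℝ => √(c * δ) := by fun_prop
    have := (hc.tendsto 0).mono_left (nhdsWithin_le_nhds (s := Set.Ioi 0))
    rwa [mul_zero, Real.sqrt_zero] at this
  exact (h.eventually_lt_const hs₀).mono fun δ => le_of_lt

end Asymptotic

end TotalCorr

end

/-! ### Assembly of the three assertions. -/

theorem theorem1 {d : ℕ} {X : Fin d → Type*} [∀ i, Fintype (X i)] [∀ i, DecidableEq (X i)]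
    {𝒰 : Type*} [Fintype 𝒰] [Nontrivial 𝒰]
    (P : (∀ i, X i) → ℝ) (hP : P ∈ stdSimplex ℝ (∀ i, X i))
    (hpos : ∀ i a, 0 < coordMarginal P i a) (hX : ∃ i, Nontrivial (X i))
    (γ : ℝ) (hγ : 0 < γ) (hγU : γ * Fintype.card 𝒰 < 1)
    (ψ : (Σ i, X i) → ℝ) (hψ : IsSecondEigenvector P ψ) :
    -- the optimal value
    (∃ V : ℝ → ℝ,
      (∀ δ, 0 < δ → IsLUB (reduction '' feasible 𝒰 P γ δ) (V δ)) ∧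
      (fun δ => V δ - δ * (eig P 1 - 1)) =o[𝓝[>] 0] (fun δ => δ)) ∧
    -- attainment by the members of the exponential family
    ((∀ PU ∈ stdSimplex ℝ 𝒰, (∀ u, γ < PU u) → ∀ δ, 0 < δ → (expFamily P ψ PU δ).Nonempty) ∧
      ∀ (PU : ℝ → 𝒰 → ℝ) (R : ℝ → 𝒰 × (∀ i, X i) → ℝ),
        (∀ᶠ δ in 𝓝[>] 0, PU δ ∈ stdSimplex ℝ 𝒰 ∧ (∀ u, γ < PU δ u) ∧
          R δ ∈ expFamily P ψ (PU δ) δ) →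
        (fun δ => mutualInfo (R δ) - δ) =o[𝓝[>] 0] (fun δ => δ) ∧
        (∀ x, (fun δ => marginalX (R δ) x - P x) =O[𝓝[>] 0] (fun δ => δ)) ∧
        (∀ u, (fun δ => marginalU (R δ) u - PU δ u) =O[𝓝[>] 0] (fun δ => δ)) ∧
        (fun δ => reduction (R δ) - δ * (eig P 1 - 1)) =o[𝓝[>] 0] (fun δ => δ) ∧
        ∃ Q : ℝ → 𝒰 × (∀ i, X i) → ℝ,
          (∀ᶠ δ in 𝓝[>] 0, Q δ ∈ feasible 𝒰 P γ δ) ∧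
          (fun δ => reduction (Q δ) - δ * (eig P 1 - 1)) =o[𝓝[>] 0] (fun δ => δ) ∧
          ∀ u x, (fun δ => Q δ (u, x) - R δ (u, x)) =o[𝓝[>] 0] (fun δ => Real.sqrt δ)) ∧
    -- every near-optimal joint law is close to a member of the exponential family
    (1 < eig P 1 → eig P 2 < eig P 1 →
      ∀ Q : ℝ → 𝒰 × (∀ i, X i) → ℝ,
        (∀ᶠ δ in 𝓝[>] 0, Q δ ∈ feasible 𝒰 P γ δ) →
        (fun δ => reduction (Q δ) - δ * (eig P 1 - 1)) =o[𝓝[>] 0] (fun δ => δ) →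
        ∃ R : ℝ → 𝒰 × (∀ i, X i) → ℝ,
          (∀ᶠ δ in 𝓝[>] 0, R δ ∈ expFamily P ψ (marginalU (Q δ)) δ) ∧
          ∀ u x, (fun δ => Q δ (u, x) - R δ (u, x)) =o[𝓝[>] 0] (fun δ => Real.sqrt δ)) := by
  have hev := one_le_eig_one hP.1 hP.2 hpos hX
  obtain ⟨C, s₀, hs₀, hC⟩ :=
    exists_bounds_expFamily (𝒰 := 𝒰) hψ hP.1 hP.2 hpos hev hγ
  have hnonempty : ∀ PU ∈ stdSimplex ℝ 𝒰, (∀ u, γ < PU u) → ∀ δ : ℝ, 0 < δ →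
      (expFamily P ψ PU δ).Nonempty := fun PU _ hPUγ δ _ => by
    obtain ⟨h, hh⟩ := unitFunctions_nonempty fun u => hγ.trans (hPUγ u)
    exact ⟨_, h, hh, rfl⟩
  have hsmall : ∀ᶠ δ in 𝓝[>] (0 : ℝ), 0 < δ ∧ √(2 * δ) ≤ s₀ :=
    (eventually_mem_nhdsWithin.mono fun δ hδ => hδ).and (eventually_sqrt_mul_le 2 hs₀)
  refine ⟨⟨fun δ => sSup (reduction '' feasible 𝒰 P γ δ), fun δ hδ => ?_, ?_⟩,
    ⟨hnonempty, fun PU R hR => ?_⟩, fun h1 h2 Q hQ hQr => ?_⟩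
  · refine isLUB_csSup ((feasible_nonempty hP hγU hδ).image _) ⟨totalCorrelation P, ?_⟩
    rintro _ ⟨Q, hQ, rfl⟩
    exact reduction_le_totalCorrelation hγ hQ
  · obtain ⟨C', s₁, hs₁, hC'⟩ := exists_reduction_le (𝒰 := 𝒰) hP.1 hP.2 hpos hX hγ
    have hcard : (0 : ℝ) < Fintype.card 𝒰 := by exact_mod_cast Fintype.card_pos
    have hPU1 : ∑ _u : 𝒰, (Fintype.card 𝒰 : ℝ)⁻¹ = 1 := by
      rw [Finset.sum_const, Finset.card_univ, nsmul_eq_mul, mul_inv_cancel₀ hcard.ne']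
    have hPUγ : ∀ _u : 𝒰, γ < (Fintype.card 𝒰 : ℝ)⁻¹ := fun _ => by
      rwa [← one_div, lt_div_iff₀ hcard]
    -- The lower bound on the supremum comes from the feasible law near a family member with uniform
    -- base law. The signs of C and C' are unknown, hence the absolute values.
    refine isLittleO_of_abs_le ((sqrt_two_mul_pow_three_isLittleO |C|).add
      (isLittleO_sqrt_pow_three.const_mul_left |C'|)) ?_
    have hsmall₁ := eventually_sqrt_mul_le 1 hs₁
    simp only [one_mul] at hsmall₁
    filter_upwards [hsmall, hsmall₁] with δ hδ hδ₁
    obtain ⟨R, hR⟩ := hnonempty (fun _ => (Fintype.card 𝒰 : ℝ)⁻¹)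
      ⟨fun _ => by positivity, hPU1⟩ hPUγ δ hδ.1
    obtain ⟨-, -, -, -, Q, hQ, hQr, -⟩ := hC δ hδ.1 hδ.2 _ hPU1 hPUγ R hR
    have hle := le_csSup (a := reduction Q) (s := reduction '' feasible 𝒰 P γ δ)
      ⟨totalCorrelation P, by
        rintro _ ⟨Q, hQ, rfl⟩
        exact reduction_le_totalCorrelation hγ hQ⟩ ⟨Q, hQ, rfl⟩
    have hge : sSup (reduction '' feasible 𝒰 P γ δ) ≤ δ * (eig P 1 - 1) + C' * √δ ^ 3 := by
      refine csSup_le (Set.Nonempty.image _ ⟨Q, hQ⟩) ?_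
      rintro _ ⟨Q', hQ', rfl⟩
      exact hC' δ hδ₁ Q' hQ'
    have hp : 0 ≤ √(2 * δ) ^ 3 := by positivity
    have hp' : 0 ≤ √δ ^ 3 := by positivity
    have b1 := mul_le_mul_of_nonneg_right (le_abs_self C) hp
    have b2 := mul_le_mul_of_nonneg_right (le_abs_self C') hp'
    have b3 := mul_nonneg (abs_nonneg C) hp
    have b4 := mul_nonneg (abs_nonneg C') hp'
    rw [abs_le] at hQr ⊢
    constructor <;> linarith
  · have hb := hsmall.and hR |>.mono fun δ h =>
      hC δ h.1.1 h.1.2 (PU δ) h.2.1.2 h.2.2.1 (R δ) h.2.2.2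
    refine ⟨isLittleO_of_abs_le (sqrt_two_mul_pow_three_isLittleO C) (hb.mono fun δ h => h.1),
      fun x => isBigO_of_abs_le (sqrt_two_mul_sq_isBigO C) (hb.mono fun δ h => h.2.1 x),
      fun u => isBigO_of_abs_le (sqrt_two_mul_sq_isBigO C) (hb.mono fun δ h => h.2.2.1 u),
      isLittleO_of_abs_le (sqrt_two_mul_pow_three_isLittleO C) (hb.mono fun δ h => h.2.2.2.1),
      ?_⟩
    -- The bounds are uniform, so a law may be chosen for each small δ independently.
    obtain ⟨Q, hQ⟩ := (hb.mono fun δ h => h.2.2.2.2).choice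
    exact ⟨Q, hQ.mono fun δ h => h.1,
      isLittleO_of_abs_le (sqrt_two_mul_pow_three_isLittleO C) (hQ.mono fun δ h => h.2.1),
      fun u x => (isBigO_of_abs_le (sqrt_two_mul_sq_isBigO C)
        (hQ.mono fun δ h => h.2.2 (u, x))).trans_isLittleO isLittleO_id_sqrt⟩
  · obtain ⟨D, C', s₁, hs₁, hD⟩ :=
      exists_expFamily_near (𝒰 := 𝒰) hψ hP.1 hP.2 hpos hX hγ h1 h2
    -- Near optimality makes A = o(δ), so the distance bound √A + δ is o(√δ).
    set A : ℝ → ℝ := fun δ => D * (√δ ^ 3 + |reduction (Q δ) - δ * (eig P 1 - 1)|) with hA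
    have hAo : A =o[𝓝[>] 0] fun δ => δ :=
      (isLittleO_sqrt_pow_three.add hQr.abs_left).const_mul_left D
    have hAδ : ∀ᶠ δ in 𝓝[>] (0 : ℝ), A δ ≤ δ := by
      filter_upwards [(isLittleO_iff.1 hAo) one_pos, self_mem_nhdsWithin] with δ h hδ
      rw [one_mul, Real.norm_of_nonneg (le_of_lt hδ)] at h
      exact (le_abs_self _).trans h
    have hsmall₁ := eventually_sqrt_mul_le 1 hs₁
    simp only [one_mul] at hsmall₁
    have hR : ∀ᶠ δ in 𝓝[>] (0 : ℝ), ∃ R, R ∈ expFamily P ψ (marginalU (Q δ)) δ ∧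
        ∀ z, |Q δ z - R z| ≤ C' * (√(A δ) + δ) := by
      filter_upwards [hQ, hAδ, hsmall₁, self_mem_nhdsWithin] with δ h3 h4 h5 h6
      exact hD δ h6 h5 (Q δ) h3 (A δ) rfl h4
    obtain ⟨R, hR⟩ := hR.choice
    exact ⟨R, hR.mono fun δ h => h.1, fun u x => isLittleO_of_abs_le
      (((isLittleO_sqrt_of_isLittleO hAo).add isLittleO_id_sqrt).const_mul_left C')
      (hR.mono fun δ h => h.2 (u, x))⟩
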